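/- Let $n\ge 2$, let $D\subset\mathbb C^n$ be a domain and $a\in\partial D$. Suppose that $D$ is $\mathcal C^\infty$-smooth near $a$, i.e. on a neighbourhood of $a$ one has $D=\{\rho<0\}$ with $\rho$ a real $\mathcal C^\infty$ function such that $d\rho\ne0$ at the points of $\partial D$. Suppose also that $D$ is $\mathbb C$-convex near $a$, i.e. there is an open neighbourhood $U$ of $a$ such that every non-empty intersection of $D\cap U$ with a complex line is connected and simply connected. Notation. The type of $a$ is the supremum of the orders of contact with $\partial D$ of the one-dimensional analytic varieties through $a$, that is, of $\operatorname{ord}_0(\rho\circ\gamma)/\operatorname{ord}_0(\gamma-a)$ over all non-constant germs of holomorphic maps $\gamma:(\mathbb C,0)\to(\mathbb C^n,a)$. Let $T_a^{\mathbb C}\partial D$ be the complex tangent space, $n_a=\{a-t\nabla\rho(a):t>0\}$ the inner normal half-line, $\delta_D(z)$ the distance from $z$ to $\mathbb C^n\setminus D$, and, with $\mathbb D$ the unit disc, $$l_D^*(z,w)=\inf\left\{\left|\frac{\zeta-\eta}{1-\bar\zeta\eta}\right| : \zeta,\eta\in\mathbb D,\ \exists\,\varphi\in\mathcal O(\mathbb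 D,D),\ \varphi(\zeta)=z,\ \varphi(\eta)=w\right\}.$$ (i) If $a$ is of finite type $2m$ (where $m\ge1$ is an integer), there exist a unit vector $X\in T_a^{\mathbb C}\partial D$, $\varepsilon>0$ and $C>0$ such that for all $z\in n_a$ with $|z-a|<\varepsilon$ and all $\lambda\in\mathbb C$ with $C|\lambda|/\delta_D(z)^{1/2m}<1$, the point $w=z+\lambda X$ lies in $D$ and $$l_D^*(z,w)\le C\,\frac{|z-w|}{\delta_D(z)^{1/2m}}.$$ (ii) If $a$ is of infinite type, there exist a unit vector $X\in T_a^{\mathbb C}\partial D$ and $\varepsilon>0$ such that for every integer $m\ge1$ there is $C=C_m>0$ for which the conclusion of (i) holds, with these $X$ and $\varepsilon$, for all $z\in n_a$ with $|z-a|<\varepsilon$ and all $\lambda\in\mathbb C$ with $C_m|\lambda|/\delta_D(z)^{1/2m}<1$. -/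

import Mathlib

open Set Filter Topology
open scoped ENNReal ContDiff

/-- Complex Euclidean space `ℂⁿ`, with its Hermitian norm. -/
abbrev Cn (n : ℕ) : Type := EuclideanSpace ℂ (Fin n)

/-- The complex affine line through `p` with direction `v` (a line when `v ≠ 0`). -/
def complexLine {n : ℕ} (p v : Cn n) : Set (Cn n) := {x | ∃ t : ℂ, x = p + t • v}

/-- `S` is `ℂ`-convex: each non-empty intersection with a complex line is connected and
simply connected. -/
def IsCConvex {n : ℕ} (S : Set (Cn n)) : Prop :=
  ∀ p v : Cn n, v ≠ 0 → (S ∩ complexLine p v).Nonempty →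
    IsConnected (S ∩ complexLine p v) ∧ IsSimplyConnected (S ∩ complexLine p v)

/-- `S` is `ℂ`-convex near `a`: its intersection with some neighbourhood of `a` is `ℂ`-convex. -/
def IsCConvexNear {n : ℕ} (S : Set (Cn n)) (a : Cn n) : Prop :=
  ∃ U : Set (Cn n), IsOpen U ∧ a ∈ U ∧ IsCConvex (S ∩ U)

/-- `ρ` is a smooth (`C^∞`) defining function of `D` near `a`. -/
def IsSmoothDefiningFunctionNear {n : ℕ} (D : Set (Cn n)) (a : Cn n) (ρ : Cn n → ℝ) : Prop :=
  ∃ U : Set (Cn n), IsOpen U ∧ a ∈ U ∧ ContDiffOn ℝ ∞ ρ U ∧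
    D ∩ U = {x | x ∈ U ∧ ρ x < 0} ∧ ∀ x ∈ frontier D ∩ U, fderiv ℝ ρ x ≠ 0

/-- Order of vanishing at `0` of a function of one complex variable: the supremum of the `k`
with `f(ζ) = O(|ζ|^k)` (for a smooth `f`, the order of its Taylor series at `0`). -/
noncomputable def vanishingOrder {F : Type*} [NormedAddCommGroup F] (f : ℂ → F) : ℕ∞ :=
  ⨆ (k : ℕ) (_ : f =O[𝓝 0] fun ζ : ℂ => ‖ζ‖ ^ k), (k : ℕ∞)

/-- The type at `a` of the hypersurface `{ρ = 0}`: the supremum of the orders of contact with it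
of the one-dimensional analytic varieties through `a`. An irreducible germ of such a variety is
the image of a non-constant holomorphic germ `γ` with `γ(0) = a`, and its order of contact is
`ord₀ (ρ ∘ γ) / ord₀ (γ - a)`. -/
noncomputable def contactType {n : ℕ} (ρ : Cn n → ℝ) (a : Cn n) : ℝ≥0∞ :=
  ⨆ (γ : ℂ → Cn n)
    (_ : AnalyticAt ℂ γ 0 ∧ γ 0 = a ∧ ¬ (∀ᶠ ζ in 𝓝 (0 : ℂ), γ ζ = a)),
    ((vanishingOrder fun ζ => ρ (γ ζ) : ℕ∞) : ℝ≥0∞) /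
      ((vanishingOrder fun ζ => γ ζ - a : ℕ∞) : ℝ≥0∞)

/-- The complex tangent space at `a` of `{ρ = 0}`, the largest complex subspace of `ker dρ(a)`. -/
def complexTangent {n : ℕ} (ρ : Cn n → ℝ) (a : Cn n) : Set (Cn n) :=
  {X | fderiv ℝ ρ a X = 0 ∧ fderiv ℝ ρ a (Complex.I • X) = 0}

/-- The open inner normal half-line at `a`: the points `a - t ∇ρ(a)`, `t > 0`, the gradient being
taken for the real inner product `Re ⟪·,·⟫`. -/
def innerNormal {n : ℕ} (ρ : Cn n → ℝ) (a : Cn n) : Set (Cn n) :=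
  {z | ∃ t : ℝ, 0 < t ∧ ∀ X : Cn n, (inner ℂ (z - a) X).re = -t * fderiv ℝ ρ a X}

/-- The distance `δ_D(z)` from `z` to the complement of `D`. -/
noncomputable def bdryDist {n : ℕ} (D : Set (Cn n)) (z : Cn n) : ℝ := Metric.infDist z Dᶜ

/-- The Lempert function `l*_D(z,w)`: the infimum of the pseudo-hyperbolic distances of `ζ, η` in
the unit disc for which some holomorphic `φ : 𝔻 → D` has `φ(ζ) = z`, `φ(η) = w` (and `⊤` if there
is no such `φ`). -/
noncomputable def lempertStar {n : ℕ} (D : Set (Cn n)) (z w : Cn n) : ℝ≥0∞ :=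
  ⨅ (ζ : ℂ) (η : ℂ) (_ : ζ ∈ Metric.ball (0 : ℂ) 1 ∧ η ∈ Metric.ball (0 : ℂ) 1 ∧
      ∃ φ : ℂ → Cn n, DifferentiableOn ℂ φ (Metric.ball 0 1) ∧
        MapsTo φ (Metric.ball 0 1) D ∧ φ ζ = z ∧ φ η = w),
    ENNReal.ofReal ‖(ζ - η) / (1 - (starRingEnd ℂ) ζ * η)‖

/-! The estimate comes from an affine disc. If `ρ (a + ζ • X) ≤ C₀ |ζ| ^ (2m)` near `0`, then adding
the inner normal vector `w = z - a` lowers `ρ` by a multiple of `‖w‖ ≥ δ_D(z)`. So the disc with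
centre `z`, direction `X` and radius `δ_D(z) ^ (1/2m) / C` lies in `D` (`exists_lempertStar_le`).

It remains to see that complex lines already detect the type: if `γ ζ = a + ζ ^ s • g ζ`, `g 0 ≠ 0`,
satisfies `ρ (γ ζ) ≤ K |ζ| ^ N`, then `ρ (a + τ • g 0) = O(|τ| ^ (N/s))`. Convexity enters only
through topology: a complex line tangent to the boundary misses the local piece of `D`
(`IsCConvex.add_notMem`), since otherwise nearby tilted lines would carry logarithms with
contradictory monodromy. Hence normalised complex linear forms `ℓ x` satisfy `Re ℓ x (y - x) ≤ ρ y`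
up to a small error (`exists_isSupportSystem`).

For a boundary point `x` near `a`, the function `b ζ = ℓ x (γ ζ - x)` is holomorphic, and Harnack's
inequality gives `Re b ≲ r ^ N + r ^ s |b 0|` on `|ζ| ≤ r`. Let `x = y - h • ν` be the boundary
point under `y = a + τ • g 0`; then `ρ y` is comparable to `h = ℓ x (y - x)`, a combination of
Taylor coefficients of `b` which Carathéodory's inequality bounds in the same way. Since `|b 0|` is
at most twice a bound `M` of `ρ` on a larger disc of the tangent line, this is a recursion `ρ y ≲ r
^ N + r ^ s M` (`exists_recursion`), which iterates to `r ^ N`.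

Contact of order greater than `k` is a closed condition on the unit vector `X`, so for infinite type
compactness yields one `X` good for all `m`. -/

/-! ### Complex analysis in the disc -/

/-- A Harnack inequality: a holomorphic function on a disc with values in the slit plane is
controlled on the half disc by its value at the centre. -/
theorem norm_le_of_mapsTo_slitPlane {f : ℂ → ℂ} {r : ℝ} (hr : 0 < r)
    (hf : DifferentiableOn ℂ f (Metric.ball 0 r))
    (hs : MapsTo f (Metric.ball 0 r) Complex.slitPlane) {z : ℂ} (hz : ‖z‖ ≤ r / 2) :
    ‖f z‖ ≤ 9 * ‖f 0‖ := by
  -- The principal square root maps the slit plane into the right half plane. Borel–Carathéodory for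
  -- `-v` then costs a factor 3 on the half disc, hence 9 after squaring.
  set v : ℂ → ℂ := fun ζ => Complex.exp (Complex.log (f ζ) / 2) with hv
  have hvd : DifferentiableOn ℂ v (Metric.ball 0 r) :=
    ((hf.clog fun x hx => hs hx).div_const 2).cexp
  have hvre : ∀ ζ ∈ Metric.ball (0 : ℂ) r, 0 ≤ (v ζ).re := by
    intro ζ _
    rw [hv, Complex.exp_re]
    refine mul_nonneg (Real.exp_pos _).le (Real.cos_nonneg_of_mem_Icc ?_)
    have h1 := Complex.neg_pi_lt_arg (f ζ)
    have h2 := Complex.arg_le_pi (f ζ)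
    have h3 : (Complex.log (f ζ) / 2).im = Complex.arg (f ζ) / 2 := by
      rw [← Complex.log_im, show (2 : ℂ) = ((2 : ℝ) : ℂ) by norm_num, Complex.div_ofReal_im]
    rw [h3]
    constructor <;> linarith
  have hsq : ∀ ζ ∈ Metric.ball (0 : ℂ) r, ‖v ζ‖ ^ 2 = ‖f ζ‖ := by
    intro ζ hζ
    rw [← norm_pow, hv]
    simp only
    rw [← Complex.exp_nat_mul]
    push_cast
    rw [mul_div_cancel₀ _ (two_ne_zero), Complex.exp_log (Complex.slitPlane_ne_zero (hs hζ))]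
  have hz' : z ∈ Metric.ball (0 : ℂ) r := by
    rw [mem_ball_zero_iff]; linarith
  have hden : 0 < r - ‖z‖ := by linarith
  have key : ∀ M : ℝ, 0 < M → ‖v z‖ ≤ 3 * ‖v 0‖ + M := by
    intro M hM
    have h := Complex.borelCaratheodory (f := fun ζ => -v ζ) (R := r) (z := z) (M := M / 2)
      (by positivity) hvd.neg
      (fun ζ hζ => by
        have := hvre ζ hζ
        simp only [mem_ofPred_eq, Complex.neg_re]; linarith) hr hz'
    simp only [norm_neg] at h
    have h1 : 2 * (M / 2) * ‖z‖ / (r - ‖z‖) ≤ M := by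
      rw [div_le_iff₀ hden]; nlinarith
    have h2 : ‖v 0‖ * (r + ‖z‖) / (r - ‖z‖) ≤ 3 * ‖v 0‖ := by
      rw [div_le_iff₀ hden]; nlinarith [norm_nonneg (v 0)]
    linarith
  have h3 : ‖v z‖ ≤ 3 * ‖v 0‖ := le_of_forall_pos_le_add key
  rw [← hsq z hz', ← hsq 0 (Metric.mem_ball_self hr)]
  nlinarith [norm_nonneg (v z)]

/-- Maximum principle for the real part. -/
theorem re_nonneg_of_re_nonneg_sphere {H : ℂ → ℂ} {r : ℝ} (hr : 0 < r)
    (hH : DiffContOnCl ℂ H (Metric.ball 0 r)) (hre : ∀ ζ : ℂ, ‖ζ‖ = r → 0 ≤ (H ζ).re) :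
    0 ≤ (H 0).re := by
  have hd : DiffContOnCl ℂ (fun ζ => Complex.exp (-H ζ)) (Metric.ball 0 r) :=
    Complex.differentiable_exp.comp_diffContOnCl hH.neg
  have h := Complex.norm_le_of_forall_mem_frontier_norm_le Metric.isBounded_ball hd (C := 1)
    (fun z hz => by
      rw [frontier_ball _ hr.ne', mem_sphere_zero_iff_norm] at hz
      rw [Complex.norm_exp, Real.exp_le_one_iff, Complex.neg_re]
      linarith [hre z hz]) (subset_closure (Metric.mem_ball_self hr))
  rw [Complex.norm_exp, Real.exp_le_one_iff, Complex.neg_re] at h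
  linarith

/-- Carathéodory's coefficient inequality for a function `c + ζ ^ s * k ζ`. -/
theorem re_add_half_mul_le {k : ℂ → ℂ} {r B : ℝ} {s : ℕ} (c : ℂ) (hr : 0 < r) (hs : s ≠ 0)
    (hk : DiffContOnCl ℂ k (Metric.ball 0 r))
    (hB : ∀ ζ : ℂ, ‖ζ‖ = r → (c + ζ ^ s * k ζ).re ≤ B) {w : ℂ} (hw : ‖w‖ = r ^ s) :
    (c + w / 2 * k 0).re ≤ B := by
  set q : ℂ := B - c with hq
  set R : ℂ := (((r ^ s) ^ 2 : ℝ) : ℂ) with hR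
  have hR0 : R ≠ 0 := by rw [hR]; exact_mod_cast (by positivity : ((r ^ s) ^ 2 : ℝ) ≠ 0)
  -- With `F = B - (c + ζ ^ s * k ζ)` and the unimodular `e = conj w * ζ ^ s / R`, the aim is `Re H
  -- = Re F * (1 + Re e) ≥ 0` on the circle. There `conj e * ζ ^ s = w`, so `conj e * F = conj e * q
  -- - w * k ζ`; replacing `conj e * q` by its conjugate makes everything holomorphic without
  -- changing the real part.
  set H : ℂ → ℂ := fun ζ => (q - ζ ^ s * k ζ) + 1 / 2 * (starRingEnd ℂ w * ζ ^ s / R) *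
    (q - ζ ^ s * k ζ) - 1 / 2 * w * k ζ + 1 / 2 * (starRingEnd ℂ (w * q) * ζ ^ s / R) with hHdef
  have hpow : DiffContOnCl ℂ (fun ζ : ℂ => ζ ^ s) (Metric.ball 0 r) :=
    (differentiable_pow s).diffContOnCl
  have hF : DiffContOnCl ℂ (fun ζ => q - ζ ^ s * k ζ) (Metric.ball 0 r) :=
    (hpow.smul hk).const_sub q
  have hE : ∀ u : ℂ, DiffContOnCl ℂ (fun ζ : ℂ => 1 / 2 * (u * ζ ^ s / R)) (Metric.ball 0 r) :=
    fun u => Differentiable.diffContOnCl (by fun_prop)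
  have hH : DiffContOnCl ℂ H (Metric.ball 0 r) :=
    ((hF.add ((hE _).smul hF)).sub (hk.const_smul (1 / 2 * w))).add (hE _)
  have h0 := re_nonneg_of_re_nonneg_sphere hr hH (fun ζ hζ => ?_)
  · have : H 0 = B - (c + w / 2 * k 0) := by
      simp only [hHdef, zero_pow hs, hq]; ring
    rw [this, Complex.sub_re, Complex.ofReal_re] at h0
    linarith
  · set F : ℂ := q - ζ ^ s * k ζ with hFdef
    have hFre : 0 ≤ F.re := by
      have := hB ζ hζ
      have e : F = B - (c + ζ ^ s * k ζ) := by rw [hFdef, hq]; ring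
      rw [e, Complex.sub_re, Complex.ofReal_re]; linarith
    set e : ℂ := starRingEnd ℂ w * ζ ^ s / R with he
    have hζs : ζ ^ s * starRingEnd ℂ (ζ ^ s) = R := by
      rw [Complex.mul_conj, Complex.normSq_eq_norm_sq, norm_pow, hζ]
    have hce : starRingEnd ℂ e * ζ ^ s = w := by
      rw [he, map_div₀, map_mul, Complex.conj_conj, hR, Complex.conj_ofReal, ← hR]
      rw [div_mul_eq_mul_div, mul_assoc, mul_comm (starRingEnd ℂ (ζ ^ s)), hζs,
        mul_div_cancel_right₀ _ hR0]
    have hnorm : ‖e‖ = 1 := by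
      rw [he, norm_div, norm_mul, RCLike.norm_conj, hw, norm_pow, hζ, hR, Complex.norm_real,
        Real.norm_of_nonneg (by positivity)]
      field_simp
    have hHζ : H ζ = F + 1 / 2 * (e * F) + 1 / 2 * (starRingEnd ℂ e * F) -
        1 / 2 * (starRingEnd ℂ e * q) + 1 / 2 * starRingEnd ℂ (starRingEnd ℂ e * q) := by
      have e1 : w * k ζ = starRingEnd ℂ e * (q - F) := by
        rw [hFdef, ← hce]; ring
      have e2 : starRingEnd ℂ (w * q) * ζ ^ s / R = starRingEnd ℂ (starRingEnd ℂ e * q) := by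
        rw [map_mul, map_mul, Complex.conj_conj, he]; ring
      simp only [hHdef]
      rw [← hFdef, ← he, e2, mul_assoc (1 / 2 : ℂ) w, e1]
      ring
    have hval : (H ζ).re = F.re * (1 + e.re) := by
      rw [hHζ]
      simp [Complex.add_re, Complex.mul_re, Complex.mul_im]
      ring
    rw [hval]
    have : |e.re| ≤ 1 := hnorm ▸ Complex.abs_re_le_norm e
    have := abs_le.1 this
    exact mul_nonneg hFre (by linarith)

/-! ### Taylor expansion at a point -/

section Taylor

variable {E : Type*} [NormedAddCommGroup E] [NormedSpace ℝ E]

/-- Taylor's theorem with the remainder estimated by a power of the norm. -/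
theorem exists_norm_sub_taylor_le {f : E → ℝ} {a : E} (hf : ContDiffAt ℝ ∞ f a) (k : ℕ) :
    ∃ C : ℝ, 0 < C ∧ ∃ ε : ℝ, 0 < ε ∧ ∀ v : E, ‖v‖ < ε →
      |f (a + v) - ∑ i ∈ Finset.range k, (i.factorial : ℝ)⁻¹ *
        iteratedFDeriv ℝ i f a (fun _ => v)| ≤ C * ‖v‖ ^ k := by
  have hcont : ContinuousAt (iteratedFDeriv ℝ k f) a :=
    (hf.iteratedFDeriv_right (i := k) (m := 0) (by simp; exact_mod_cast le_top)).continuousAt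
  set C : ℝ := ‖iteratedFDeriv ℝ k f a‖ + 1 with hC
  have h1 : ∀ᶠ x in 𝓝 a, ‖iteratedFDeriv ℝ k f x‖ < C :=
    hcont.norm.eventually (gt_mem_nhds (by linarith))
  have h2 : ∀ᶠ x in 𝓝 a, ContDiffAt ℝ (k : ℕ) f x :=
    (hf.of_le (by exact_mod_cast le_top)).eventually (by simp)
  obtain ⟨ε, hε, hball⟩ := Metric.eventually_nhds_iff.1 (h1.and h2)
  have hCpos : 0 < C := by positivity
  refine ⟨C, hCpos, ε, hε, fun v hv => ?_⟩
  have hin : ∀ t ∈ Icc (0 : ℝ) 1, dist (a + t • v) a < ε := by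
    intro t ht
    rw [dist_eq_norm, add_sub_cancel_left, norm_smul, Real.norm_of_nonneg ht.1]
    exact (mul_le_of_le_one_left (norm_nonneg v) ht.2).trans_lt hv
  have hbd : ∀ t ∈ Icc (0 : ℝ) 1,
      |iteratedFDeriv ℝ k f (a + t • v) (fun _ => v)| ≤ C * ‖v‖ ^ k := by
    intro t ht
    refine ((iteratedFDeriv ℝ k f (a + t • v)).le_opNorm _).trans ?_
    simp only [Finset.prod_const, Finset.card_univ, Fintype.card_fin]
    gcongr
    exact (hball (hin t ht)).1.le
  rcases k with _ | n
  · simpa using hbd 1 (by simp)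
  · rw [map_add_eq_sum_add_integral_iteratedFDeriv (f := f) (x := a) (y := v) (n := n)
      (fun t ht => by exact_mod_cast (hball (hin t ht)).2)]
    simp only [smul_eq_mul, add_sub_cancel_left]
    rw [abs_mul]
    have hI : |∫ t in (0 : ℝ)..1, (1 - t) ^ n * iteratedFDeriv ℝ (n + 1) f (a + t • v)
        (fun _ => v)| ≤ C * ‖v‖ ^ (n + 1) := by
      have := intervalIntegral.norm_integral_le_of_norm_le_const (a := (0 : ℝ)) (b := 1)
        (f := fun t => (1 - t) ^ n * iteratedFDeriv ℝ (n + 1) f (a + t • v) (fun _ => v))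
        (C := C * ‖v‖ ^ (n + 1)) (fun t ht => by
          rw [uIoc_of_le zero_le_one] at ht
          rw [norm_mul, Real.norm_eq_abs, Real.norm_eq_abs]
          have h3 : |(1 - t) ^ n| ≤ 1 := by
            rw [abs_pow]
            exact pow_le_one₀ (abs_nonneg _) (abs_le.2 ⟨by linarith [ht.2], by linarith [ht.1]⟩)
          exact (mul_le_of_le_one_left (abs_nonneg _) h3).trans (hbd t ⟨ht.1.le, ht.2⟩))
      simpa using this
    refine (mul_le_of_le_one_left (abs_nonneg _) ?_).trans hI
    rw [abs_of_nonneg (by positivity)]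
    exact inv_le_one_of_one_le₀ (by exact_mod_cast Nat.one_le_iff_ne_zero.2 (Nat.factorial_ne_zero n))

/-- A polynomial of degree at most `k` which is `o(t ^ k)` vanishes. -/
theorem eq_zero_of_sum_isLittleO (k : ℕ) (c : ℕ → ℝ)
    (h : (fun t : ℝ => ∑ i ∈ Finset.range (k + 1), c i * t ^ i) =o[𝓝[>] 0] fun t => t ^ k) :
    ∀ i ≤ k, c i = 0 := by
  induction k generalizing c with
  | zero =>
    intro i hi
    obtain rfl : i = 0 := by omega
    simp only [zero_add, Finset.range_one, Finset.sum_singleton, pow_zero, mul_one] at h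
    exact tendsto_nhds_unique tendsto_const_nhds ((Asymptotics.isLittleO_one_iff ℝ).1 h)
  | succ k ih =>
    have h0 : c 0 = 0 := by
      have t1 : Tendsto (fun t : ℝ => ∑ i ∈ Finset.range (k + 1 + 1), c i * t ^ i) (𝓝[>] 0)
          (𝓝 (∑ i ∈ Finset.range (k + 1 + 1), c i * (0 : ℝ) ^ i)) :=
        (Continuous.tendsto (by fun_prop) 0).mono_left nhdsWithin_le_nhds
      have t2 : Tendsto (fun t : ℝ => t ^ (k + 1)) (𝓝[>] 0) (𝓝 0) := by
        have : Tendsto (fun t : ℝ => t ^ (k + 1)) (𝓝 0) (𝓝 (0 ^ (k + 1))) :=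
          (continuous_pow _).tendsto 0
        rw [zero_pow (by omega)] at this
        exact this.mono_left nhdsWithin_le_nhds
      have := tendsto_nhds_unique t1 (h.isBigO.trans_tendsto t2)
      rw [Finset.sum_range_succ'] at this
      simpa using this
    have h1 : (fun t : ℝ => ∑ i ∈ Finset.range (k + 1), c (i + 1) * t ^ i)
        =o[𝓝[>] 0] fun t => t ^ k := by
      rw [Asymptotics.isLittleO_iff] at h ⊢
      intro ε hε
      filter_upwards [h hε, self_mem_nhdsWithin] with t ht htpos
      rw [mem_Ioi] at htpos
      rw [Finset.sum_range_succ', h0, zero_mul, add_zero] at ht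
      have e : ∑ i ∈ Finset.range (k + 1), c (i + 1) * t ^ (i + 1) =
          (∑ i ∈ Finset.range (k + 1), c (i + 1) * t ^ i) * t := by
        rw [Finset.sum_mul]
        exact Finset.sum_congr rfl fun i _ => by ring
      rw [e, pow_succ, norm_mul, norm_mul, ← mul_assoc] at ht
      exact le_of_mul_le_mul_right ht (norm_pos_iff.2 htpos.ne')
    intro i hi
    rcases i with _ | i
    · exact h0
    · exact ih (fun i => c (i + 1)) h1 i (by omega)

/-- If a smooth function is `o(t ^ k)` along the ray in the direction `v`, then its Taylor
coefficients of order at most `k` in that direction vanish. -/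
theorem iteratedFDeriv_eq_zero_of_isLittleO {f : E → ℝ} {a v : E} (hf : ContDiffAt ℝ ∞ f a)
    {k : ℕ} (h : (fun t : ℝ => f (a + t • v)) =o[𝓝[>] 0] fun t => t ^ k) :
    ∀ i ≤ k, iteratedFDeriv ℝ i f a (fun _ => v) = 0 := by
  obtain ⟨C, hC, ε, hε, hT⟩ := exists_norm_sub_taylor_le hf (k + 1)
  have hsm : Tendsto (fun t : ℝ => t • v) (𝓝[>] 0) (𝓝 0) := by
    have : Tendsto (fun t : ℝ => t • v) (𝓝 0) (𝓝 ((0 : ℝ) • v)) :=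
      Continuous.tendsto (by fun_prop) 0
    rw [zero_smul] at this
    exact this.mono_left nhdsWithin_le_nhds
  have hrem : (fun t : ℝ => f (a + t • v) - ∑ i ∈ Finset.range (k + 1),
      ((i.factorial : ℝ)⁻¹ * iteratedFDeriv ℝ i f a (fun _ => v)) * t ^ i)
      =o[𝓝[>] 0] fun t => t ^ k := by
    refine Asymptotics.IsBigO.trans_isLittleO (g := fun t : ℝ => t ^ (k + 1)) ?_
      ((Asymptotics.isLittleO_pow_pow (𝕜 := ℝ) (Nat.lt_succ_self k)).mono nhdsWithin_le_nhds)
    refine Asymptotics.IsBigO.of_bound (C * ‖v‖ ^ (k + 1)) ?_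
    filter_upwards [hsm.eventually (Metric.ball_mem_nhds 0 hε)] with t ht
    have := hT (t • v) (by simpa using ht)
    rw [norm_smul, mul_pow] at this
    rw [Real.norm_eq_abs, norm_pow]
    refine le_trans (le_of_eq ?_) (this.trans (le_of_eq (by ring)))
    congr 2
    refine Finset.sum_congr rfl fun i _ => ?_
    rw [(iteratedFDeriv ℝ i f a).map_smul_univ (fun _ => t) (fun _ => v)]
    simp only [Finset.prod_const, Finset.card_univ, Fintype.card_fin, smul_eq_mul]
    ring
  have := h.sub hrem
  simp only [sub_sub_cancel] at this
  intro i hi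
  have := eq_zero_of_sum_isLittleO k _ this i hi
  exact (mul_eq_zero.1 this).resolve_left (inv_ne_zero (by exact_mod_cast Nat.factorial_ne_zero i))

end Taylor

/-! ### Complex lines tangent to a `ℂ`-convex set -/

/-- Two continuous logarithms of the same function on a preconnected set agree when they agree
at one point. -/
theorem eqOn_of_exp_eqOn {A : Type*} [TopologicalSpace A] {s : Set A} (hs : IsPreconnected s)
    {f g : A → ℂ} (hf : ContinuousOn f s) (hg : ContinuousOn g s)
    (h : ∀ x ∈ s, Complex.exp (f x) = Complex.exp (g x)) {x₀ : A} (hx₀ : x₀ ∈ s)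
    (h₀ : f x₀ = g x₀) : EqOn f g s :=
  Complex.isCoveringMap_exp.eqOn_of_comp_eqOn hs hf hg
    (fun x hx => Subtype.ext (h x hx)) hx₀ h₀

/-- There is no family of simply connected open plane sets `W u`, `‖u‖ = 1`, open in `u`, such that
all of them omit `0` and contain `1`, and `W u` contains `-c / u`. -/
theorem false_of_rotating_family {W : ℂ → Set ℂ} {c : ℝ}
    (hW : IsOpen {p : ℂ × ℂ | p.2 ∈ W p.1}) (hsc : ∀ u : ℂ, ‖u‖ = 1 → IsSimplyConnected (W u))
    (h0 : ∀ u, 0 ∉ W u) (h1 : ∀ u : ℂ, ‖u‖ = 1 → (1 : ℂ) ∈ W u)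
    (hrot : ∀ u : ℂ, ‖u‖ = 1 → -(c : ℂ) * u⁻¹ ∈ W u) : False := by
  have hWo : ∀ u, IsOpen (W u) := fun u => hW.preimage (Continuous.prodMk_right u)
  -- Each `W u` carries a logarithm normalised to vanish at `1`; following it at `-c / u` around the
  -- unit circle produces the contradiction.
  have hlog : ∀ u : ℂ, ‖u‖ = 1 → ∃ f : ℂ → ℂ, ContinuousOn f (W u) ∧
      (∀ z ∈ W u, Complex.exp (f z) = z) ∧ f 1 = 0 := by
    intro u hu
    obtain ⟨f, hf, hfe⟩ := Complex.exists_continuousOn_eqOn_exp_comp (hsc u hu) (hWo u)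
      (g := fun z => z) continuousOn_id (by simpa using h0 u)
    refine ⟨fun z => f z - f 1, hf.sub continuousOn_const, fun z hz => ?_, sub_self _⟩
    have e1 : Complex.exp (f z) = z := hfe hz
    have e2 : Complex.exp (f 1) = 1 := hfe (h1 u hu)
    rw [Complex.exp_sub, e1, e2, div_one]
  choose! f hfc hfe hf1 using hlog
  set e : ℝ → ℂ := fun θ => Complex.exp (θ * Complex.I) with he
  have hen : ∀ θ, ‖e θ‖ = 1 := fun θ => Complex.norm_exp_ofReal_mul_I θ
  have hec : Continuous e := by fun_prop
  have hene : ∀ θ, e θ ≠ 0 := fun θ => Complex.exp_ne_zero _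
  set q : ℝ → ℂ := fun θ => -(c : ℂ) * (e θ)⁻¹ with hq
  have hqc : Continuous q := continuous_const.mul (hec.inv₀ hene)
  -- A path from `1` to `q θ₀` in `W (e θ₀)`, together with a small ball at its end, stays inside `W
  -- u` for `u` near `e θ₀`. The two branches agree at `1`, hence on this connected set.
  have hcont : Continuous fun θ => f (e θ) (q θ) := by
    rw [continuous_iff_continuousAt]
    intro θ₀
    have hq0 : q θ₀ ∈ W (e θ₀) := hrot _ (hen θ₀)
    obtain ⟨p, hp⟩ := (hsc _ (hen θ₀)).isPathConnected.joinedIn 1 (h1 _ (hen θ₀)) _ hq0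
    have hnb : {p : ℂ × ℂ | p.2 ∈ W p.1} ∈ 𝓝 (e θ₀, q θ₀) := hW.mem_nhds hq0
    obtain ⟨N, hN, B, hB, hNB⟩ := mem_nhds_prod_iff.1 hnb
    obtain ⟨r, hr, hrB⟩ := Metric.mem_nhds_iff.1 hB
    have htube : ∀ᶠ u in 𝓝 (e θ₀), ∀ z ∈ range p, z ∈ W u := by
      obtain ⟨N', M, hN', -, hsN, hsM, hNM⟩ := generalized_tube_lemma (isCompact_singleton (x := e θ₀))
        (isCompact_range p.continuous) hW (by
          rintro ⟨u, z⟩ ⟨hu, t, rfl⟩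
          obtain rfl : u = e θ₀ := hu
          exact hp t)
      filter_upwards [hN'.mem_nhds (hsN rfl)] with u hu z hz
      exact hNM (mk_mem_prod hu (hsM hz))
    have hK : IsPreconnected (range p ∪ Metric.ball (q θ₀) r) :=
      (isPreconnected_range p.continuous).union (q θ₀) ⟨1, p.target⟩ (Metric.mem_ball_self hr)
        (convex_ball _ _).isPreconnected
    have hev : ∀ᶠ θ in 𝓝 θ₀, f (e θ) (q θ) = f (e θ₀) (q θ) := by
      filter_upwards [hec.continuousAt.eventually htube, hec.continuousAt.eventually hN,
        hqc.continuousAt.eventually (Metric.ball_mem_nhds _ hr)] with θ hθ1 hθ2 hθ3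
      have sub : ∀ u, (∀ z ∈ range p, z ∈ W u) → u ∈ N →
          range p ∪ Metric.ball (q θ₀) r ⊆ W u := by
        rintro u hu huN z (hz | hz)
        · exact hu z hz
        · exact hNB (mk_mem_prod huN (hrB hz))
      have s1 := sub _ hθ1 hθ2
      have s2 := sub _ htube.self_of_nhds (mem_of_mem_nhds hN)
      refine eqOn_of_exp_eqOn hK ((hfc _ (hen θ)).mono s1) ((hfc _ (hen θ₀)).mono s2)
        (fun z hz => ?_) (Or.inl ⟨0, p.source⟩) ?_ (Or.inr hθ3)
      · rw [hfe _ (hen θ) z (s1 hz), hfe _ (hen θ₀) z (s2 hz)]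
      · rw [hf1 _ (hen θ), hf1 _ (hen θ₀)]
    refine ContinuousAt.congr_of_eventuallyEq ?_ hev
    exact ContinuousAt.comp (f := q) (g := f (e θ₀))
      ((hfc _ (hen θ₀)).continuousAt ((hWo _).mem_nhds hq0)) hqc.continuousAt
  -- This is a continuous logarithm of the constant `-c`, hence constant; but over a full turn its
  -- first term returns and its second grows by `2πi`.
  have hG : Continuous fun θ : ℝ => f (e θ) (q θ) + θ * Complex.I :=
    hcont.add (by fun_prop)
  have hGe : ∀ θ : ℝ, Complex.exp (f (e θ) (q θ) + θ * Complex.I) = -c := by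
    intro θ
    rw [Complex.exp_add, hfe _ (hen θ) _ (hrot _ (hen θ)), mul_assoc, inv_mul_cancel₀ (hene θ),
      mul_one]
  have := eqOn_of_exp_eqOn isPreconnected_univ hG.continuousOn
    (continuousOn_const (c := f (e 0) (q 0) + (0 : ℝ) * Complex.I))
    (fun θ _ => (hGe θ).trans (hGe 0).symm) (mem_univ 0) rfl (mem_univ (2 * Real.pi))
  have e2 : e (2 * Real.pi) = e 0 := by
    simp only [he]; push_cast; rw [Complex.exp_two_pi_mul_I]; simp
  simp only [hq, e2] at this
  have h3 := add_left_cancel this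
  simp [Real.pi_ne_zero] at h3

/-- A complex line tangent at a boundary point to a `ℂ`-convex open set does not meet it: here the
set contains the points near `x` where `ρ < 0`. -/
theorem IsCConvex.add_notMem {n : ℕ} {S : Set (Cn n)} (hS : IsCConvex S) (hSo : IsOpen S)
    {x V : Cn n} (hx : x ∉ S) {ρ : Cn n → ℝ} (hρ : DifferentiableAt ℝ ρ x) (hρx : ρ x = 0)
    (hloc : ∀ᶠ y in 𝓝 x, ρ y < 0 → y ∈ S) (hd : fderiv ℝ ρ x ≠ 0)
    (hV : fderiv ℝ ρ x V = 0) (hIV : fderiv ℝ ρ x (Complex.I • V) = 0) : x + V ∉ S := by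
  intro hxV
  set L := fderiv ℝ ρ x with hL
  have hLV : ∀ u : ℂ, L (u • V) = 0 := by
    intro u
    have : u • V = u.re • V + u.im • (Complex.I • V) := by
      rw [← Complex.coe_smul u.re V, ← Complex.coe_smul u.im, smul_smul, ← add_smul,
        Complex.re_add_im]
    rw [this, map_add, map_smul, map_smul, hV, hIV]; simp
  obtain ⟨ν, hν⟩ : ∃ ν, L ν = 1 := by
    obtain ⟨v, hv⟩ : ∃ v, L v ≠ 0 := by
      by_contra! h; exact hd (ContinuousLinearMap.ext h)
    exact ⟨(L v)⁻¹ • v, by rw [map_smul, smul_eq_mul, inv_mul_cancel₀ hv]⟩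
  obtain ⟨δ, hδ, hball⟩ := Metric.isOpen_iff.1 hSo _ hxV
  set σ : ℝ := δ / (2 * (‖ν‖ + 1)) with hσ
  have hσ0 : 0 < σ := by positivity
  have hσν : σ * ‖ν‖ < δ := by
    rw [hσ, div_mul_eq_mul_div, div_lt_iff₀ (by positivity)]; nlinarith [norm_nonneg ν]
  -- The tangent direction is tilted by `σ u ν`. For small `σ` the parameter `1` still gives a point
  -- of `S`. At `-c / u` the tilt contributes `-cσν` for every `u` while `L` kills the part along
  -- `V`, so `ρ < 0` there for small `c`, uniformly in `u`.
  set dir : ℂ → Cn n := fun u => V + ((σ : ℂ) * u) • ν with hdir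
  set W : ℂ → Set ℂ := fun u => {τ | x + τ • dir u ∈ S} with hWdef
  have hdirc : Continuous fun p : ℂ × ℂ => x + p.2 • dir p.1 := by
    simp only [hdir]; fun_prop
  have hdir_rot : ∀ u : ℂ, ‖u‖ = 1 → u⁻¹ • dir u = u⁻¹ • V + σ • ν := by
    intro u hu
    have hu0 : u ≠ 0 := by rintro rfl; simp at hu
    simp only [hdir]
    rw [smul_add, smul_smul, mul_comm, mul_assoc, mul_inv_cancel₀ hu0, mul_one, Complex.coe_smul]
  have hdir_ne : ∀ u : ℂ, ‖u‖ = 1 → dir u ≠ 0 := by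
    intro u hu h
    have := hdir_rot u hu
    rw [h, smul_zero] at this
    have h2 := congrArg L this
    rw [map_zero, map_add, hLV, map_smul, hν] at h2
    simp at h2; linarith
  set M : ℝ := ‖V‖ + σ * ‖ν‖ + 1 with hM
  have hMpos : 0 < M := by positivity
  obtain ⟨c, hc, hcW⟩ : ∃ c : ℝ, 0 < c ∧ ∀ u : ℂ, ‖u‖ = 1 → -(c : ℂ) * u⁻¹ ∈ W u := by
    have hlo := (hasFDerivAt_iff_isLittleO.1 hρ.hasFDerivAt).bound
      (show 0 < σ / (2 * M) by positivity)
    obtain ⟨ε, hε, hεb⟩ := Metric.eventually_nhds_iff.1 (hlo.and hloc)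
    refine ⟨ε / (2 * M), by positivity, fun u hu => ?_⟩
    set c : ℝ := ε / (2 * M) with hc
    have hc0 : 0 < c := by positivity
    have hy : x + (-(c : ℂ) * u⁻¹) • dir u = x + -(c • (u⁻¹ • V + σ • ν)) := by
      rw [← hdir_rot u hu, ← Complex.coe_smul, smul_smul, neg_mul, neg_smul]
    simp only [hWdef, mem_ofPred_eq]
    rw [hy]
    set w : Cn n := u⁻¹ • V + σ • ν with hw
    have hwn : ‖w‖ ≤ M := by
      refine (norm_add_le _ _).trans ?_
      rw [norm_smul, norm_inv, hu, inv_one, one_mul, norm_smul, Real.norm_of_nonneg hσ0.le, hM]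
      linarith
    have hcw : ‖-(c • w)‖ ≤ c * M := by
      rw [norm_neg, norm_smul, Real.norm_of_nonneg hc0.le]; gcongr
    have hcM : c * M = ε / 2 := by rw [hc]; field_simp
    have hyin : dist (x + -(c • w)) x < ε := by
      rw [dist_eq_norm, add_sub_cancel_left]; linarith
    obtain ⟨h1, h2⟩ := hεb hyin
    refine h2 ?_
    rw [add_sub_cancel_left, hρx, sub_zero, ← hL, map_neg, map_smul, hw, map_add, hLV, map_smul,
      hν, ← hw, Real.norm_eq_abs] at h1
    have h3 := (abs_le.1 h1).2
    have h4 : σ / (2 * M) * ‖-(c • w)‖ ≤ σ / (2 * M) * (c * M) := by gcongr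
    have h5 : σ / (2 * M) * (c * M) = c * σ / 2 := by field_simp
    simp only [smul_eq_mul, mul_one, zero_add] at h3
    have : 0 < c * σ := by positivity
    linarith
  refine false_of_rotating_family (W := W) (c := c) (hSo.preimage hdirc) (fun u hu => ?_)
    (fun u => by simpa [hWdef] using hx) (fun u hu => hball ?_) hcW
  · have hemb : IsEmbedding fun τ : ℂ => x + τ • dir u :=
      (Homeomorph.addLeft x).isEmbedding.comp
        (isClosedEmbedding_smul_left (hdir_ne u hu)).isEmbedding
    rw [← hemb.isSimplyConnected_image]
    have him : (fun τ : ℂ => x + τ • dir u) '' W u = S ∩ complexLine x (dir u) := by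
      ext y
      constructor
      · rintro ⟨τ, hτ, rfl⟩; exact ⟨hτ, τ, rfl⟩
      · rintro ⟨hy, τ, rfl⟩; exact ⟨τ, hy, rfl⟩
    rw [him]
    exact (hS x (dir u) (hdir_ne u hu) ⟨_, him ▸ mem_image_of_mem _ (hcW u hu)⟩).2
  · rw [mem_ball_iff_norm, one_smul, hdir]
    simp only
    rw [show x + (V + ((σ : ℂ) * u) • ν) - (x + V) = ((σ : ℂ) * u) • ν by abel, norm_smul, norm_mul,
      hu, mul_one, Complex.norm_real, Real.norm_of_nonneg hσ0.le]
    exact hσν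

/-! ### Holomorphic support functions -/

/-- A system of complex linear forms `ℓ x`, normalised by `ℓ x ν = 1`, such that at the points `x`
of `{ρ = 0}` near `a` the complex tangent hyperplane `ℓ x (y - x) = 0` is a support of `{ρ < 0}`,
in a quantitative form. -/
structure IsSupportSystem {n : ℕ} (ρ : Cn n → ℝ) (a ν : Cn n) (ℓ : Cn n → Cn n →L[ℂ] ℂ)
    (R C : ℝ) : Prop where
  R_pos : 0 < R
  C_pos : 0 < C
  apply_zero : ρ a = 0
  continuousOn : ContinuousOn ρ (Metric.ball a R)
  apply_normal : ∀ x ∈ Metric.ball a R, ℓ x ν = 1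
  norm_le : ∀ x ∈ Metric.ball a R, ∀ v, ‖ℓ x v‖ ≤ C * ‖v‖
  abs_le : ∀ y ∈ Metric.ball a R, |ρ y| ≤ C * ‖y - a‖
  normal_le : ∀ y ∈ Metric.ball a R, ∀ h : ℝ, 0 ≤ h → y - h • ν ∈ Metric.ball a R →
    h / 2 ≤ ρ y - ρ (y - h • ν) ∧ ρ y - ρ (y - h • ν) ≤ 2 * h
  support : ∀ x ∈ Metric.ball a R, ρ x = 0 → ∀ y ∈ Metric.ball a R,
    (ℓ x (y - x)).re - C * ‖ℓ x (y - x)‖ * (‖y - a‖ + ‖ℓ x (y - x)‖) ≤ ρ y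

set_option maxHeartbeats 1000000 in
/-- Support by the complex tangent hyperplanes yields a support system. -/
theorem exists_isSupportSystem {n : ℕ} {ρ : Cn n → ℝ} {a : Cn n} (hρ : ContDiffAt ℝ ∞ ρ a)
    (h0 : ρ a = 0) (hd : fderiv ℝ ρ a ≠ 0)
    (hsupp : ∃ R : ℝ, 0 < R ∧ ∀ x ∈ Metric.ball a R, ρ x = 0 → ∀ V, x + V ∈ Metric.ball a R →
      fderiv ℝ ρ x V = 0 → fderiv ℝ ρ x (Complex.I • V) = 0 → 0 ≤ ρ (x + V)) :
    ∃ ν ℓ R C, IsSupportSystem ρ a ν ℓ R C := by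
  obtain ⟨R₀, hR₀, hsupp⟩ := hsupp
  set A : Cn n → (Cn n →L[ℂ] ℂ) := fun x =>
    StrongDual.extendRCLike (fderiv ℝ ρ x) with hA
  have hAre : ∀ x v, (A x v).re = fderiv ℝ ρ x v :=
    fun x v => StrongDual.re_extendRCLike_apply (𝕜 := ℂ) (fderiv ℝ ρ x) v
  have hAn : ∀ x, ‖A x‖ = ‖fderiv ℝ ρ x‖ :=
    fun x => StrongDual.norm_extendRCLike (𝕜 := ℂ) (fderiv ℝ ρ x)
  obtain ⟨ν, hν⟩ : ∃ ν, A a ν = 1 := by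
    obtain ⟨v, hv⟩ : ∃ v, fderiv ℝ ρ a v ≠ 0 := by
      by_contra! h; exact hd (ContinuousLinearMap.ext h)
    have hv' : A a v ≠ 0 := fun h => hv (by rw [← hAre, h, Complex.zero_re])
    exact ⟨(A a v)⁻¹ • v, by rw [map_smul, smul_eq_mul, inv_mul_cancel₀ hv']⟩
  have hle : ∀ m : ℕ, (m : WithTop ℕ∞) ≤ (∞ : WithTop ℕ∞) := fun m => by exact_mod_cast le_top
  have hC1 : ContDiffAt ℝ 1 (fderiv ℝ ρ) a :=
    (hρ.of_le (hle 2)).fderiv_right (m := 1) (by norm_num)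
  obtain ⟨K, t, ht, hlip⟩ := hC1.exists_lipschitzOnWith
  have hdiff : ∀ᶠ x in 𝓝 a, DifferentiableAt ℝ ρ x :=
    ((hρ.of_le (m := 1) (by exact_mod_cast le_top)).eventually (by simp)).mono
      fun x hx => hx.differentiableAt one_ne_zero
  obtain ⟨R₁, hR₁, hb⟩ := Metric.eventually_nhds_iff.1 (hdiff.and ht)
  -- On the ball of radius `R₂ ≤ 1 / (2κ)` the differential varies so little that `|A x ν| ≥ 1/2`,
  -- which permits the normalisation of `ℓ x`.
  set κ : ℝ := K * ‖ν‖ + K + 1 with hκ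
  have hκ0 : 0 < κ := by positivity
  set R₂ : ℝ := min (min R₀ R₁) (1 / (2 * κ)) with hR₂
  have hR₂0 : 0 < R₂ := by positivity
  have hR₂κ : R₂ * κ ≤ 1 / 2 := by
    have : R₂ ≤ 1 / (2 * κ) := min_le_right _ _
    calc R₂ * κ ≤ 1 / (2 * κ) * κ := by gcongr
      _ = 1 / 2 := by field_simp
  have hsub0 : Metric.ball a R₂ ⊆ Metric.ball a R₀ :=
    Metric.ball_subset_ball ((min_le_left _ _).trans (min_le_left _ _))
  have hsub1 : ∀ x ∈ Metric.ball a R₂, DifferentiableAt ℝ ρ x ∧ x ∈ t := fun x hx =>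
    hb (lt_of_lt_of_le (Metric.mem_ball.1 hx) ((min_le_left _ _).trans (min_le_right _ _)))
  have hL : ∀ x ∈ Metric.ball a R₂, ‖fderiv ℝ ρ x - fderiv ℝ ρ a‖ ≤ K * ‖x - a‖ := fun x hx =>
    hlip.norm_sub_le (hsub1 x hx).2 (hsub1 a (Metric.mem_ball_self hR₂0)).2
  have hL1 : ∀ x ∈ Metric.ball a R₂, ‖fderiv ℝ ρ x - fderiv ℝ ρ a‖ ≤ K * R₂ := fun x hx =>
    (hL x hx).trans (by gcongr; exact (mem_ball_iff_norm.1 hx).le)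
  have hKR : K * R₂ * ‖ν‖ ≤ 1 / 2 := by
    refine le_trans ?_ hR₂κ
    rw [hκ]; nlinarith [K.coe_nonneg]
  have hKR' : K * R₂ ≤ 1 := by
    have : (K : ℝ) * R₂ ≤ R₂ * κ := by
      rw [hκ]; nlinarith [K.coe_nonneg, mul_nonneg hR₂0.le (mul_nonneg K.coe_nonneg (norm_nonneg ν))]
    linarith
  have hLaν : fderiv ℝ ρ a ν = 1 := by rw [← hAre, hν, Complex.one_re]
  have hAν : ∀ x ∈ Metric.ball a R₂, 1 / 2 ≤ ‖A x ν‖ := by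
    intro x hx
    refine le_trans ?_ (Complex.re_le_norm _)
    rw [hAre]
    have h1 : |(fderiv ℝ ρ x - fderiv ℝ ρ a) ν| ≤ 1 / 2 :=
      ((fderiv ℝ ρ x - fderiv ℝ ρ a).le_opNorm ν).trans
        ((mul_le_mul_of_nonneg_right (hL1 x hx) (norm_nonneg _)).trans hKR)
    rw [sub_apply, hLaν] at h1
    linarith [(abs_le.1 h1).1]
  have hAν0 : ∀ x ∈ Metric.ball a R₂, A x ν ≠ 0 := fun x hx h => by
    have := hAν x hx; rw [h, norm_zero] at this; norm_num at this
  set C₁ : ℝ := 2 * (‖fderiv ℝ ρ a‖ + 1) with hC₁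
  have hC₁0 : 0 < C₁ := by positivity
  have hfb : ∀ x ∈ Metric.ball a R₂, ‖fderiv ℝ ρ x‖ ≤ ‖fderiv ℝ ρ a‖ + 1 := by
    intro x hx
    have h1 := (hL1 x hx).trans hKR'
    have h2 := norm_le_norm_add_norm_sub' (fderiv ℝ ρ x) (fderiv ℝ ρ a)
    linarith
  set ℓ : Cn n → (Cn n →L[ℂ] ℂ) := fun x => (A x ν)⁻¹ • A x with hℓ
  have hℓap : ∀ x v, ℓ x v = (A x ν)⁻¹ * A x v := fun x v => rfl
  have hℓle : ∀ x ∈ Metric.ball a R₂, ∀ v, ‖ℓ x v‖ ≤ C₁ * ‖v‖ := by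
    intro x hx v
    rw [hℓap, norm_mul, norm_inv, hC₁, mul_assoc]
    have h1 : ‖A x ν‖⁻¹ ≤ 2 := by
      rw [inv_le_comm₀ (by linarith [hAν x hx]) two_pos]
      simpa using hAν x hx
    gcongr
    refine ((A x).le_opNorm v).trans ?_
    rw [hAn]; gcongr; exact hfb x hx
  have hmv : ∀ d ≤ R₂, ∀ x ∈ Metric.ball a d, ∀ y ∈ Metric.ball a d,
      |ρ y - ρ x - fderiv ℝ ρ a (y - x)| ≤ K * d * ‖y - x‖ := by
    intro d hdR x hx y hy
    have hsub : Metric.ball a d ⊆ Metric.ball a R₂ := Metric.ball_subset_ball hdR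
    refine Convex.norm_image_sub_le_of_norm_fderiv_le' (s := Metric.ball a d)
      (fun z hz => (hsub1 z (hsub hz)).1) (fun z hz => ?_) (convex_ball a d) hx hy
    exact (hL z (hsub hz)).trans (by gcongr; exact (mem_ball_iff_norm.1 hz).le)
  -- This keeps the projection `y - b • ν` used for the support inequality inside the ball of radius
  -- `R₂`.
  set R : ℝ := R₂ / (2 + 4 * C₁ * ‖ν‖) with hR
  have hden : 0 < 2 + 4 * C₁ * ‖ν‖ := by positivity
  have hR0 : 0 < R := by positivity
  have hRR : R * (2 + 4 * C₁ * ‖ν‖) = R₂ := by rw [hR]; field_simp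
  have hRle : R ≤ R₂ := by nlinarith [mul_nonneg hC₁0.le (norm_nonneg ν)]
  have hsub : Metric.ball a R ⊆ Metric.ball a R₂ := Metric.ball_subset_ball hRle
  set C : ℝ := C₁ + 2 * K * (1 + ‖ν‖) * ‖ν‖ with hC
  have hCC₁ : C₁ ≤ C := by rw [hC]; exact le_add_of_nonneg_right (by positivity)
  refine ⟨ν, ℓ, R, C, hR0, by positivity, h0, fun x hx =>
    (hsub1 x (hsub hx)).1.continuousAt.continuousWithinAt, fun x hx => ?_, fun x hx v => ?_,
    fun y hy => ?_, fun y hy h hh hyh => ?_, fun x hx hx0 y hy => ?_⟩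
  · rw [hℓap, inv_mul_cancel₀ (hAν0 x (hsub hx))]
  · exact (hℓle x (hsub hx) v).trans (by gcongr)
  · have h1 := hmv R₂ le_rfl a (Metric.mem_ball_self hR₂0) y (hsub hy)
    rw [h0, sub_zero] at h1
    have h2 := (fderiv ℝ ρ a).le_opNorm (y - a)
    rw [Real.norm_eq_abs] at h2
    have h3 : |ρ y| ≤ |ρ y - fderiv ℝ ρ a (y - a)| + |fderiv ℝ ρ a (y - a)| := by
      simpa using abs_add_le (ρ y - fderiv ℝ ρ a (y - a)) (fderiv ℝ ρ a (y - a))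
    calc |ρ y| ≤ K * R₂ * ‖y - a‖ + ‖fderiv ℝ ρ a‖ * ‖y - a‖ := by linarith
      _ ≤ 1 * ‖y - a‖ + ‖fderiv ℝ ρ a‖ * ‖y - a‖ := by gcongr
      _ ≤ C₁ * ‖y - a‖ := by
        rw [hC₁]; nlinarith [norm_nonneg (y - a), norm_nonneg (fderiv ℝ ρ a),
          mul_nonneg (norm_nonneg (fderiv ℝ ρ a)) (norm_nonneg (y - a))]
      _ ≤ C * ‖y - a‖ := by gcongr
  · have h1 := hmv R₂ le_rfl _ (hsub hyh) y (hsub hy)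
    rw [sub_sub_cancel, map_smul, hLaν, norm_smul, Real.norm_of_nonneg hh, smul_eq_mul,
      mul_one] at h1
    have h2 : K * R₂ * (h * ‖ν‖) ≤ h / 2 := by nlinarith
    have := abs_le.1 h1
    constructor <;> linarith [this.1, this.2]
  · set b : ℂ := ℓ x (y - x) with hb'
    have hbn : ‖b‖ ≤ C₁ * (2 * R) := by
      refine (hℓle x (hsub hx) _).trans ?_
      gcongr
      have := norm_sub_le_norm_sub_add_norm_sub y a x
      rw [norm_sub_rev a x] at this
      linarith [mem_ball_iff_norm.1 hx, mem_ball_iff_norm.1 hy]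
    set d : ℝ := ‖y - a‖ + ‖b‖ * ‖ν‖ with hdd
    have hdR : d < R₂ := by
      have h1 : ‖b‖ * ‖ν‖ ≤ C₁ * (2 * R) * ‖ν‖ := by gcongr
      have h2 := mem_ball_iff_norm.1 hy
      have h3 : 0 ≤ R * (C₁ * ‖ν‖) := by positivity
      nlinarith
    -- Projecting `y` along `ν` lands in the tangent hyperplane at `x`, where `ρ ≥ 0`. Returning to
    -- `y` changes `ρ` by `Re b`, up to the oscillation of `dρ` on a ball of radius about `d` around
    -- `a`.
    set y' : Cn n := y - b • ν with hy'
    have hy'd : ‖y' - a‖ ≤ d := by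
      rw [hy', show y - b • ν - a = (y - a) - b • ν by abel, hdd]
      exact (norm_sub_le _ _).trans (by rw [norm_smul])
    have hpos : 0 ≤ ρ y' := by
      have hℓ0 : ℓ x (y' - x) = 0 := by
        rw [hy', show y - b • ν - x = (y - x) - b • ν by abel, map_sub, map_smul, ← hb',
          hℓap x ν, inv_mul_cancel₀ (hAν0 x (hsub hx))]
        simp
      have hA0 : A x (y' - x) = 0 := by
        rw [hℓap] at hℓ0
        exact (mul_eq_zero.1 hℓ0).resolve_left (inv_ne_zero (hAν0 x (hsub hx)))
      have := hsupp x (hsub0 (hsub hx)) hx0 (y' - x)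
        (by rw [add_sub_cancel]; exact hsub0 (mem_ball_iff_norm.2 (hy'd.trans_lt hdR)))
        (by rw [← hAre, hA0, Complex.zero_re])
        (by rw [← hAre, map_smul, hA0, smul_zero, Complex.zero_re])
      rwa [add_sub_cancel] at this
    have hmain : ρ y ≥ b.re - K * d * (‖b‖ * ‖ν‖) := by
      -- The points are only known to lie in the closed ball of radius `d`, hence the slightly
      -- larger `d'`, which then tends to `d`.
      have hd' : ∀ d' : ℝ, d < d' → d' ≤ R₂ → b.re - ρ y + ρ y' ≤ K * d' * (‖b‖ * ‖ν‖) := by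
        intro d' h1 h2
        have hyd : ‖y - a‖ ≤ d := le_add_of_nonneg_right (by positivity)
        have h3 := hmv d' h2 y' (mem_ball_iff_norm.2 (hy'd.trans_lt h1)) y
          (mem_ball_iff_norm.2 (hyd.trans_lt h1))
        have h4 : fderiv ℝ ρ a (b • ν) = b.re := by
          rw [← hAre, map_smul, hν, smul_eq_mul, mul_one]
        rw [hy', sub_sub_cancel, h4, norm_smul] at h3
        linarith [(abs_le.1 h3).1]
      have hlim : Tendsto (fun d' : ℝ => K * d' * (‖b‖ * ‖ν‖)) (𝓝[>] d)
          (𝓝 (K * d * (‖b‖ * ‖ν‖))) :=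
        (Continuous.tendsto (by fun_prop) d).mono_left nhdsWithin_le_nhds
      have := ge_of_tendsto hlim (b := b.re - ρ y + ρ y') (by
        filter_upwards [Ioo_mem_nhdsGT hdR] with d' hd''
        exact hd' d' hd''.1 hd''.2.le)
      linarith
    have hfin : K * d * (‖b‖ * ‖ν‖) ≤ C * ‖b‖ * (‖y - a‖ + ‖b‖) := by
      have h1 : d ≤ (1 + ‖ν‖) * (‖y - a‖ + ‖b‖) := by
        have h2 := mul_nonneg (norm_nonneg ν) (norm_nonneg (y - a))
        rw [hdd]; linarith [norm_nonneg b]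
      calc K * d * (‖b‖ * ‖ν‖) ≤ K * ((1 + ‖ν‖) * (‖y - a‖ + ‖b‖)) * (‖b‖ * ‖ν‖) := by gcongr
        _ = (K * (1 + ‖ν‖) * ‖ν‖) * ‖b‖ * (‖y - a‖ + ‖b‖) := by ring
        _ ≤ C * ‖b‖ * (‖y - a‖ + ‖b‖) := by
          gcongr
          rw [hC]
          have : 0 ≤ (K : ℝ) * (1 + ‖ν‖) * ‖ν‖ := by positivity
          linarith
    linarith

/-! ### From curves to lines -/

/-- The data of a parametrised holomorphic curve `a + ζ ^ s • g ζ` whose contact with `{ρ = 0}`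
is of order at least `N`. -/
structure IsContactCurve {n : ℕ} (ρ : Cn n → ℝ) (a : Cn n) (g : ℂ → Cn n) (s N : ℕ)
    (r₀ G K : ℝ) : Prop where
  r₀_pos : 0 < r₀
  s_pos : 0 < s
  s_lt : s < N
  G_pos : 0 < G
  K_pos : 0 < K
  differentiableOn : DifferentiableOn ℂ g (Metric.ball 0 r₀)
  norm_le : ∀ ζ ∈ Metric.ball (0 : ℂ) r₀, ‖g ζ‖ ≤ G
  le : ∀ ζ ∈ Metric.ball (0 : ℂ) r₀, ρ (a + ζ ^ s • g ζ) ≤ K * ‖ζ‖ ^ N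

section

variable {n : ℕ} {ρ : Cn n → ℝ} {a ν : Cn n} {ℓ : Cn n → Cn n →L[ℂ] ℂ} {R C : ℝ}
  {g : ℂ → Cn n} {s N : ℕ} {r₀ G K : ℝ}

set_option maxHeartbeats 1000000 in
/-- Along a curve of high contact, the support functions are controlled by their value at the
centre. -/
theorem IsSupportSystem.exists_bound_along_curve (H : IsSupportSystem ρ a ν ℓ R C)
    (hg : IsContactCurve ρ a g s N r₀ G K) {D : ℝ} (hD : 0 < D) :
    ∃ C' : ℝ, 0 < C' ∧ ∃ ε : ℝ, 0 < ε ∧ ∀ r : ℝ, 0 < r → r < ε → 2 * r < r₀ ∧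
      ∀ x, ρ x = 0 → ‖x - a‖ ≤ D * r ^ s → ∀ ζ : ℂ, ‖ζ‖ ≤ r →
        ‖ℓ x (a + ζ ^ s • g ζ - x)‖ ≤ C' * (r ^ N + ‖ℓ x (a - x)‖) ∧
        (ℓ x (a + ζ ^ s • g ζ - x)).re ≤ C' * (r ^ N + r ^ s * ‖ℓ x (a - x)‖) := by
  have hR := H.R_pos
  have hC := H.C_pos
  have hG := hg.G_pos
  have hK := hg.K_pos
  have hs := hg.s_pos
  have hr₀ := hg.r₀_pos
  set G' : ℝ := 2 ^ s * G with hG'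
  set D₁ : ℝ := C * (G' + D) with hD₁
  set D₂ : ℝ := C * (G' + D₁) with hD₂
  set K' : ℝ := K * 2 ^ N with hK'
  have hG'0 : 0 < G' := by positivity
  have hD₁0 : 0 < D₁ := by positivity
  have hD₂0 : 0 < D₂ := by positivity
  have hK'0 : 0 < K' := by positivity
  set Q : ℝ := 10 * (2 * K' + 1) + 9 with hQ
  have hQ0 : 0 < Q := by positivity
  refine ⟨K' + (D₂ + 1) * Q, by positivity,
    min (min 1 (r₀ / 2)) (min (R / (G' + D)) (1 / (2 * D₂))), by positivity, fun r hr hrε => ?_⟩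
  have hr1 : r < 1 := hrε.trans_le ((min_le_left _ _).trans (min_le_left _ _))
  have hr2 : 2 * r < r₀ := by
    have : r < r₀ / 2 := hrε.trans_le ((min_le_left _ _).trans (min_le_right _ _))
    linarith
  have hr3 : r * (G' + D) < R := by
    rw [← lt_div_iff₀ (by positivity)]
    exact hrε.trans_le ((min_le_right _ _).trans (min_le_left _ _))
  have hr4 : D₂ * r ≤ 1 / 2 := by
    have : r < 1 / (2 * D₂) := hrε.trans_le ((min_le_right _ _).trans (min_le_right _ _))
    rw [lt_div_iff₀ (by positivity)] at this
    linarith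
  have hrs : r ^ s ≤ r := pow_le_of_le_one hr.le hr1.le hs.ne'
  have hrs0 : 0 < r ^ s := by positivity
  have hrN0 : 0 < r ^ N := by positivity
  have hrs1 : r ^ s ≤ 1 := hrs.trans hr1.le
  refine ⟨hr2, fun x hx0 hxa => ?_⟩
  have hxR : x ∈ Metric.ball a R := mem_ball_iff_norm.2 (by nlinarith)
  have hsub : Metric.ball (0 : ℂ) (2 * r) ⊆ Metric.ball 0 r₀ := Metric.ball_subset_ball hr2.le
  set b : ℂ → ℂ := fun ζ => ℓ x (a + ζ ^ s • g ζ - x) with hb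
  have hb0 : b 0 = ℓ x (a - x) := by simp [hb, hs.ne']
  have hγ : ∀ ζ ∈ Metric.ball (0 : ℂ) (2 * r), ‖a + ζ ^ s • g ζ - a‖ ≤ G' * r ^ s := by
    intro ζ hζ
    rw [add_sub_cancel_left, norm_smul, norm_pow]
    calc ‖ζ‖ ^ s * ‖g ζ‖ ≤ (2 * r) ^ s * G := by
          gcongr
          · exact (mem_ball_zero_iff.1 hζ).le
          · exact hg.norm_le ζ (hsub hζ)
      _ = G' * r ^ s := by rw [mul_pow, hG']; ring
  have hbn : ∀ ζ ∈ Metric.ball (0 : ℂ) (2 * r), ‖b ζ‖ ≤ D₁ * r ^ s := by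
    intro ζ hζ
    refine (H.norm_le x hxR _).trans ?_
    have : ‖a + ζ ^ s • g ζ - x‖ ≤ G' * r ^ s + D * r ^ s := by
      refine (norm_sub_le_norm_sub_add_norm_sub _ a _).trans ?_
      rw [norm_sub_rev a x]
      exact add_le_add (hγ ζ hζ) hxa
    calc C * ‖a + ζ ^ s • g ζ - x‖ ≤ C * (G' * r ^ s + D * r ^ s) := by gcongr
      _ = D₁ * r ^ s := by rw [hD₁]; ring
  have hsup : ∀ ζ ∈ Metric.ball (0 : ℂ) (2 * r),
      (b ζ).re ≤ K' * r ^ N + D₂ * r ^ s * ‖b ζ‖ := by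
    intro ζ hζ
    have h1 := H.support x hxR hx0 (a + ζ ^ s • g ζ) (mem_ball_iff_norm.2
      ((hγ ζ hζ).trans_lt (by nlinarith)))
    have h2 : K * ‖ζ‖ ^ N ≤ K' * r ^ N := by
      rw [hK', mul_assoc, ← mul_pow]
      gcongr
      exact (mem_ball_zero_iff.1 hζ).le
    have h3 : C * ‖b ζ‖ * (‖a + ζ ^ s • g ζ - a‖ + ‖b ζ‖) ≤ D₂ * r ^ s * ‖b ζ‖ := by
      calc C * ‖b ζ‖ * (‖a + ζ ^ s • g ζ - a‖ + ‖b ζ‖)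
          ≤ C * ‖b ζ‖ * (G' * r ^ s + D₁ * r ^ s) := by
            gcongr
            · exact hγ ζ hζ
            · exact hbn ζ hζ
        _ = D₂ * r ^ s * ‖b ζ‖ := by rw [hD₂]; ring
    have h4 := hg.le ζ (hsub hζ)
    change (b ζ).re - C * ‖b ζ‖ * (‖a + ζ ^ s • g ζ - a‖ + ‖b ζ‖) ≤ _ at h1
    linarith
  -- If `b ζ` were real and at least `η`, then `hsup` with `D₂ * r ^ s ≤ 1/2` would give `b ζ ≤ 2 *
  -- K' * r ^ N < η`. So `η - b` takes values in the slit plane.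
  set η : ℝ := (2 * K' + 1) * r ^ N with hη
  have hη0 : 0 < η := by positivity
  have hbd : DifferentiableOn ℂ b (Metric.ball 0 (2 * r)) := by
    have hgd := hg.differentiableOn.mono hsub
    have h1 : DifferentiableOn ℂ (fun ζ : ℂ => a + ζ ^ s • g ζ - x) (Metric.ball 0 (2 * r)) := by
      fun_prop
    exact (ℓ x).differentiable.comp_differentiableOn h1
  have hslit : MapsTo (fun ζ => (η : ℂ) - b ζ) (Metric.ball 0 (2 * r)) Complex.slitPlane := by
    intro ζ hζ
    rw [Complex.mem_slitPlane_iff]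
    by_contra! hcon
    simp only [Complex.sub_re, Complex.ofReal_re, Complex.sub_im, Complex.ofReal_im, zero_sub,
      neg_eq_zero, sub_nonpos] at hcon
    have hbre : b ζ = ((b ζ).re : ℂ) := Complex.ext (by simp) (by simp [hcon.2])
    have hnb : ‖b ζ‖ = (b ζ).re := by
      rw [hbre, Complex.norm_real, Real.norm_of_nonneg (by simpa using hη0.le.trans hcon.1)]; simp
    have h1 := hsup ζ hζ
    rw [hnb] at h1
    have h2 : D₂ * r ^ s ≤ 1 / 2 := le_trans (by gcongr) hr4
    have h3 : D₂ * r ^ s * (b ζ).re ≤ 1 / 2 * (b ζ).re :=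
      mul_le_mul_of_nonneg_right h2 (hη0.le.trans hcon.1)
    have h4 := hcon.1
    rw [hη] at h4
    nlinarith
  intro ζ hζ
  have hζ2 : ζ ∈ Metric.ball (0 : ℂ) (2 * r) := mem_ball_zero_iff.2 (by linarith)
  have hhar := norm_le_of_mapsTo_slitPlane (f := fun ζ => (η : ℂ) - b ζ) (by positivity : 0 < 2 * r)
    (hbd.const_sub _) hslit (z := ζ) (by linarith)
  have hηn : ‖(η : ℂ)‖ = η := by rw [Complex.norm_real, Real.norm_of_nonneg hη0.le]
  have hb1 : ‖b ζ‖ ≤ 10 * η + 9 * ‖b 0‖ := by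
    have h1 := norm_sub_norm_le (b ζ) η
    rw [norm_sub_rev, hηn] at h1
    have h2 := norm_sub_le (η : ℂ) (b 0)
    rw [hηn] at h2
    linarith
  have hb2 : ‖b ζ‖ ≤ Q * (r ^ N + ‖b 0‖) := by
    refine hb1.trans ?_
    rw [hη, hQ]
    nlinarith [norm_nonneg (b 0), mul_nonneg hK'0.le (norm_nonneg (b 0))]
  rw [← hb0]
  change ‖b ζ‖ ≤ _ ∧ (b ζ).re ≤ _
  have hsum : 0 ≤ r ^ N + ‖b 0‖ := by positivity
  constructor
  · refine hb2.trans ?_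
    gcongr
    nlinarith
  -- Feeding the Harnack bound back into `hsup` puts the factor `r ^ s` in front of `‖b 0‖`; this
  -- gain drives the recursion.
  · refine (hsup ζ hζ2).trans ?_
    have h1 : D₂ * r ^ s * ‖b ζ‖ ≤ D₂ * r ^ s * (Q * (r ^ N + ‖b 0‖)) := by gcongr
    have h2 : r ^ s * r ^ N ≤ r ^ N := mul_le_of_le_one_left hrN0.le hrs1
    have h3 : D₂ * r ^ s * (Q * (r ^ N + ‖b 0‖)) ≤ D₂ * Q * (r ^ N + r ^ s * ‖b 0‖) := by
      have : D₂ * r ^ s * (Q * (r ^ N + ‖b 0‖)) = D₂ * Q * (r ^ s * r ^ N + r ^ s * ‖b 0‖) := by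
        ring
      rw [this]; gcongr
    have h4 : 0 ≤ r ^ s * ‖b 0‖ := by positivity
    nlinarith [mul_nonneg hK'0.le h4, mul_nonneg hQ0.le h4, mul_nonneg hQ0.le hrN0.le]

/-- The initial direction of a curve of high contact is complex tangential. -/
theorem IsSupportSystem.apply_direction_eq_zero (H : IsSupportSystem ρ a ν ℓ R C)
    (hg : IsContactCurve ρ a g s N r₀ G K) : ℓ a (g 0) = 0 := by
  obtain ⟨C', hC', ε, hε, h⟩ := H.exists_bound_along_curve hg one_pos
  have hs := hg.s_pos
  have hcont : ContinuousAt (fun r : ℝ => ‖ℓ a (g r)‖) 0 := by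
    have h1 : ContinuousAt g ((0 : ℝ) : ℂ) := by
      rw [Complex.ofReal_zero]
      exact (hg.differentiableOn.differentiableAt (Metric.ball_mem_nhds 0 hg.r₀_pos)).continuousAt
    have h2 : ContinuousAt (fun r : ℝ => g r) 0 :=
      ContinuousAt.comp (f := fun r : ℝ => (r : ℂ)) h1 Complex.continuous_ofReal.continuousAt
    exact ((ℓ a).continuous.continuousAt.comp h2).norm
  have hlim : Tendsto (fun r : ℝ => ‖ℓ a (g r)‖) (𝓝[>] 0) (𝓝 ‖ℓ a (g 0)‖) := by
    have := hcont.tendsto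
    rw [Complex.ofReal_zero] at this
    exact this.mono_left nhdsWithin_le_nhds
  have hlim0 : Tendsto (fun r : ℝ => C' * r) (𝓝[>] 0) (𝓝 0) := by
    have : Tendsto (fun r : ℝ => C' * r) (𝓝 0) (𝓝 (C' * 0)) :=
      (continuous_const.mul continuous_id).tendsto 0
    rw [mul_zero] at this
    exact this.mono_left nhdsWithin_le_nhds
  -- For `x = a` the value at the centre is zero, so `r ^ s * ‖ℓ a (g r)‖ ≤ C' * r ^ N`, and `s < N`
  -- leaves a factor `r`.
  have hle := le_of_tendsto_of_tendsto hlim hlim0 (by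
    filter_upwards [Ioo_mem_nhdsGT (lt_min hε one_pos)] with r hr
    have h1 := ((h r hr.1 (hr.2.trans_le (min_le_left _ _))).2 a H.apply_zero
      (by rw [sub_self, norm_zero]; have := hr.1; positivity) r
      (by rw [Complex.norm_real, Real.norm_of_nonneg hr.1.le])).1
    have hr1 : r ≤ 1 := hr.2.le.trans (min_le_right _ _)
    rw [sub_self, map_zero, norm_zero, add_zero, add_sub_cancel_left, map_smul, norm_smul,
      norm_pow, Complex.norm_real, Real.norm_of_nonneg hr.1.le] at h1
    have h2 : r ^ N ≤ r ^ s * r := by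
      rw [← pow_succ]; exact pow_le_pow_of_le_one hr.1.le hr1 hg.s_lt
    have h3 : r ^ s * ‖ℓ a (g r)‖ ≤ r ^ s * (C' * r) := by
      calc r ^ s * ‖ℓ a (g r)‖ ≤ C' * r ^ N := h1
        _ ≤ C' * (r ^ s * r) := by gcongr
        _ = r ^ s * (C' * r) := by ring
    exact le_of_mul_le_mul_left h3 (pow_pos hr.1 s))
  exact norm_eq_zero.1 (le_antisymm hle (norm_nonneg _))

/-- In a complex tangential direction the defining function is non-negative. -/
theorem IsSupportSystem.nonneg_of_apply_eq_zero (H : IsSupportSystem ρ a ν ℓ R C) {X : Cn n}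
    (hX : ℓ a X = 0) {τ : ℂ} (hτ : ‖τ • X‖ < R) : 0 ≤ ρ (a + τ • X) := by
  have := H.support a (Metric.mem_ball_self H.R_pos) H.apply_zero (a + τ • X)
    (mem_ball_iff_norm.2 (by rwa [add_sub_cancel_left]))
  rw [add_sub_cancel_left, map_smul, hX] at this
  simpa using this

/-- The boundary point over a point of a complex tangential line. -/
theorem IsSupportSystem.exists_boundary_point (H : IsSupportSystem ρ a ν ℓ R C) {y : Cn n}
    (hy : 0 ≤ ρ y) (hyR : ‖y - a‖ * (1 + 2 * C * ‖ν‖) < R) :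
    ∃ h : ℝ, 0 ≤ h ∧ h ≤ 2 * C * ‖y - a‖ ∧ ρ y ≤ 2 * h ∧ ρ (y - h • ν) = 0 ∧
      ‖y - h • ν - a‖ ≤ ‖y - a‖ * (1 + 2 * C * ‖ν‖) := by
  have hC := H.C_pos
  have hyb : y ∈ Metric.ball a R := mem_ball_iff_norm.2 (by
    have : 0 ≤ ‖y - a‖ * (2 * C * ‖ν‖) := by positivity
    linarith)
  have hyC := (le_abs_self _).trans (H.abs_le y hyb)
  have hseg : ∀ h ∈ Icc (0 : ℝ) (2 * ρ y), ‖y - h • ν - a‖ ≤ ‖y - a‖ * (1 + 2 * C * ‖ν‖) := by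
    intro h hh
    rw [show y - h • ν - a = (y - a) - h • ν by abel]
    refine (norm_sub_le _ _).trans ?_
    rw [norm_smul, Real.norm_of_nonneg hh.1]
    have : h * ‖ν‖ ≤ (2 * (C * ‖y - a‖)) * ‖ν‖ := by
      gcongr; linarith [hh.2]
    linarith
  have hsegb : ∀ h ∈ Icc (0 : ℝ) (2 * ρ y), y - h • ν ∈ Metric.ball a R := fun h hh =>
    mem_ball_iff_norm.2 ((hseg h hh).trans_lt hyR)
  have hcont : ContinuousOn (fun h : ℝ => ρ (y - h • ν)) (Icc 0 (2 * ρ y)) :=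
    H.continuousOn.comp (by fun_prop) hsegb
  have hend : ρ (y - (2 * ρ y) • ν) ≤ 0 := by
    have := (H.normal_le y hyb (2 * ρ y) (by linarith)
      (hsegb _ ⟨by linarith, le_rfl⟩)).1
    linarith
  obtain ⟨h, hh, hh0⟩ := intermediate_value_Icc' (by linarith : (0 : ℝ) ≤ 2 * ρ y) hcont
    (show (0 : ℝ) ∈ Icc _ _ from ⟨hend, by simpa using hy⟩)
  refine ⟨h, hh.1, by linarith [hh.2], ?_, hh0, hseg h hh⟩
  have := (H.normal_le y hyb h hh.1 (hsegb h hh)).2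
  simp only at hh0
  linarith

/-- The recursive estimate for the defining function on the line tangent to a curve of high
contact. -/
theorem IsSupportSystem.exists_recursion (H : IsSupportSystem ρ a ν ℓ R C)
    (hg : IsContactCurve ρ a g s N r₀ G K) :
    ∃ C' : ℝ, 0 < C' ∧ ∃ ε : ℝ, 0 < ε ∧ ∀ r : ℝ, 0 < r → r < ε → ∀ τ : ℂ, ‖τ‖ = r ^ s / 2 →
      ∀ M : ℝ, (∀ τ' : ℂ, ‖τ'‖ ≤ r ^ s → ρ (a + τ' • g 0) ≤ M) →
        ρ (a + τ • g 0) ≤ C' * (r ^ N + r ^ s * M) := by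
  have hR := H.R_pos
  have hC := H.C_pos
  have hG := hg.G_pos
  have hs := hg.s_pos
  have hg0 : ‖g 0‖ ≤ G := hg.norm_le 0 (Metric.mem_ball_self hg.r₀_pos)
  set D : ℝ := G * (1 + 2 * C * ‖ν‖) with hD
  have hD0 : 0 < D := by positivity
  obtain ⟨C', hC', ε, hε, hcurve⟩ := H.exists_bound_along_curve hg hD0
  set Q : ℝ := G + 2 * C * G + C * G with hQ
  have hQ0 : 0 < Q := by positivity
  refine ⟨4 * C', by positivity, min (min ε 1) (min (R / D) (1 / (2 * C * Q))), by positivity,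
    fun r hr hrε τ hτ M hM => ?_⟩
  have hr0 : r < ε := hrε.trans_le ((min_le_left _ _).trans (min_le_left _ _))
  have hr1 : r < 1 := hrε.trans_le ((min_le_left _ _).trans (min_le_right _ _))
  have hr2 : r * D < R := by
    rw [← lt_div_iff₀ (by positivity)]
    exact hrε.trans_le ((min_le_right _ _).trans (min_le_left _ _))
  have hr3 : C * Q * r ≤ 1 / 2 := by
    have : r < 1 / (2 * C * Q) := hrε.trans_le ((min_le_right _ _).trans (min_le_right _ _))
    rw [lt_div_iff₀ (by positivity)] at this
    linarith
  obtain ⟨hr₀, hcurve⟩ := hcurve r hr hr0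
  have hrs : r ^ s ≤ r := pow_le_of_le_one hr.le hr1.le hs.ne'
  have hrs0 : 0 < r ^ s := by positivity
  have hGD : G ≤ D := by
    rw [hD]; exact le_mul_of_one_le_right hG.le (le_add_of_nonneg_right (by positivity))
  set y : Cn n := a + τ • g 0 with hy
  have hya : ‖y - a‖ ≤ r ^ s * G := by
    rw [hy, add_sub_cancel_left, norm_smul, hτ]
    calc r ^ s / 2 * ‖g 0‖ ≤ r ^ s / 2 * G := by gcongr
      _ ≤ r ^ s * G := by nlinarith [mul_pos hrs0 hG]
  have hyD : ‖y - a‖ * (1 + 2 * C * ‖ν‖) ≤ D * r ^ s := by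
    calc ‖y - a‖ * (1 + 2 * C * ‖ν‖) ≤ r ^ s * G * (1 + 2 * C * ‖ν‖) := by gcongr
      _ = D * r ^ s := by rw [hD]; ring
  have hDR : D * r ^ s < R := by nlinarith
  have hdir := H.apply_direction_eq_zero hg
  have hy0 : 0 ≤ ρ y := H.nonneg_of_apply_eq_zero hdir (by
    have : ‖τ • g 0‖ = ‖y - a‖ := by rw [hy, add_sub_cancel_left]
    rw [this]; nlinarith)
  obtain ⟨h, hh0, hhle, hyh, hx0, hxa⟩ := H.exists_boundary_point hy0 (hyD.trans_lt hDR)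
  set x : Cn n := y - h • ν with hx
  have hxD : ‖x - a‖ ≤ D * r ^ s := hxa.trans hyD
  have hxR : x ∈ Metric.ball a R := mem_ball_iff_norm.2 (hxD.trans_lt hDR)
  have hℓν : ℓ x (h • ν) = h := by
    rw [← Complex.coe_smul, map_smul, H.apply_normal x hxR, smul_eq_mul, mul_one]
  set e : ℝ := ‖τ‖ * ‖ℓ x (g 0)‖ with he
  have he0 : 0 ≤ e := by positivity
  -- convexity along the tangent line controls `h` and the slope of the support function
  obtain ⟨u, hu, hue⟩ : ∃ u : ℂ, ‖u‖ = 1 ∧ ((‖ℓ x (g 0)‖ : ℝ) : ℂ) = u * ℓ x (g 0) :=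
    RCLike.exists_norm_eq_mul_self (ℓ x (g 0))
  have hconv : h + e ≤ 2 * M := by
    -- The rotation `u` aligns the tangential term with `h`, so that the form takes the real value
    -- `h + e`; the error in the support inequality absorbs at most half of it.
    set τ' : ℂ := τ + ‖τ‖ * u with hτ'
    have hτ'n : ‖τ'‖ ≤ r ^ s := by
      refine (norm_add_le _ _).trans ?_
      rw [norm_mul, hu, Complex.norm_real, norm_norm, mul_one, hτ]; linarith
    have hb : ℓ x (a + τ' • g 0 - x) = ((h + e : ℝ) : ℂ) := by
      have e1 : a + τ' • g 0 - x = (‖τ‖ * u : ℂ) • g 0 + h • ν := by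
        rw [hx, hy, hτ', add_smul]; abel
      rw [e1, map_add, hℓν, map_smul, smul_eq_mul, mul_assoc, ← hue, he]
      push_cast; ring
    have hτa : ‖a + τ' • g 0 - a‖ ≤ r ^ s * G := by
      rw [add_sub_cancel_left, norm_smul]; gcongr
    have h1 := H.support x hxR hx0 (a + τ' • g 0)
      (mem_ball_iff_norm.2 (hτa.trans_lt (by nlinarith)))
    rw [hb, Complex.ofReal_re, Complex.norm_real, Real.norm_of_nonneg (by positivity)] at h1
    have h2 : e ≤ C * G * r ^ s := by
      calc e ≤ r ^ s * (C * ‖g 0‖) := by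
            rw [he, hτ]
            gcongr
            · linarith
            · exact H.norm_le x hxR _
        _ ≤ r ^ s * (C * G) := by gcongr
        _ = C * G * r ^ s := by ring
    have h3 : h ≤ 2 * C * (r ^ s * G) := hhle.trans (by gcongr)
    have h4 : ‖a + τ' • g 0 - a‖ + (h + e) ≤ Q * r ^ s := by
      rw [hQ]; linarith
    have h5 : C * (h + e) * (‖a + τ' • g 0 - a‖ + (h + e)) ≤ (h + e) / 2 := by
      calc C * (h + e) * (‖a + τ' • g 0 - a‖ + (h + e)) ≤ C * (h + e) * (Q * r) := by
            gcongr
            exact h4.trans (by gcongr)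
        _ = (C * Q * r) * (h + e) := by ring
        _ ≤ 1 / 2 * (h + e) := by gcongr
        _ = (h + e) / 2 := by ring
    have h6 := hM τ' hτ'n
    linarith
  have hb0 : ‖ℓ x (a - x)‖ ≤ 2 * M := by
    have e1 : a - x = h • ν - τ • g 0 := by rw [hx, hy]; abel
    rw [e1, map_sub, hℓν, map_smul]
    refine (norm_sub_le _ _).trans ?_
    rw [Complex.norm_real, Real.norm_of_nonneg hh0, norm_smul]
    exact hconv
  have hM0 : 0 ≤ M := by linarith
  have hsubball : Metric.ball (0 : ℂ) (2 * r) ⊆ Metric.ball 0 r₀ := Metric.ball_subset_ball hr₀.le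
  have hk : DiffContOnCl ℂ (fun ζ => ℓ x (g ζ)) (Metric.ball 0 r) := by
    refine DifferentiableOn.diffContOnCl_ball (U := Metric.ball (0 : ℂ) r₀) ?_
      (Metric.closedBall_subset_ball (by linarith))
    exact (ℓ x).differentiable.comp_differentiableOn hg.differentiableOn
  -- With `w = 2 * τ`, of modulus `r ^ s`, the quantity bounded is `ℓ x (a - x) + τ * ℓ x (g 0) = ℓ
  -- x (y - x) = h`, and `ρ y ≤ 2 * h`.
  have hcar := re_add_half_mul_le (s := s) (w := 2 * τ) (B := C' * (r ^ N + r ^ s * (2 * M)))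
    (ℓ x (a - x)) hr hs.ne' hk (fun ζ hζ => ?_) (by
      rw [norm_mul, hτ, RCLike.norm_ofNat]; ring)
  · have e1 : ℓ x (a - x) + 2 * τ / 2 * ℓ x (g 0) = h := by
      rw [mul_div_cancel_left₀ τ two_ne_zero, ← smul_eq_mul τ, ← map_smul, ← map_add, ← hℓν]
      congr 1
      rw [hx, hy]; abel
    rw [e1, Complex.ofReal_re] at hcar
    have h7 : C' * (r ^ N + r ^ s * (2 * M)) ≤ 2 * C' * (r ^ N + r ^ s * M) := by
      have : 0 ≤ C' * r ^ N := by positivity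
      linarith
    linarith
  · have h1 := (hcurve x hx0 hxD ζ hζ.le).2
    have e1 : ℓ x (a + ζ ^ s • g ζ - x) = ℓ x (a - x) + ζ ^ s * ℓ x (g ζ) := by
      rw [← smul_eq_mul, ← map_smul, ← map_add]; congr 1; abel
    rw [e1] at h1
    exact h1.trans (by gcongr)

theorem exists_pow_eq_of_pos {x : ℝ} (hx : 0 < x) {s : ℕ} (hs : s ≠ 0) :
    ∃ r : ℝ, 0 < r ∧ r ^ s = x :=
  ⟨x ^ ((s : ℝ)⁻¹), Real.rpow_pos_of_pos hx _, Real.rpow_inv_natCast_pow hx.le hs⟩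

/-- Each use of the recursion gains `r ^ s ≤ r`, so the exponent climbs one unit at a time from the
trivial bound until the term `r ^ N` stops it. For `‖τ‖` comparable to `r ^ s` this is contact of
order `N / s`. -/
theorem IsSupportSystem.exists_le_pow (H : IsSupportSystem ρ a ν ℓ R C)
    (hg : IsContactCurve ρ a g s N r₀ G K) {j : ℕ} (hj : j ≤ N) :
    ∃ C' : ℝ, 0 < C' ∧ ∃ ε : ℝ, 0 < ε ∧ ∀ r : ℝ, 0 < r → r < ε → ∀ τ : ℂ, ‖τ‖ ≤ r ^ s / 2 →
      ρ (a + τ • g 0) ≤ C' * r ^ j := by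
  have hR := H.R_pos
  have hC := H.C_pos
  have hG := hg.G_pos
  have hs := hg.s_pos
  have hg0 : ‖g 0‖ ≤ G := hg.norm_le 0 (Metric.mem_ball_self hg.r₀_pos)
  induction j with
  | zero =>
    refine ⟨C * R, by positivity, min 1 (R / G), by positivity, fun r hr hrε τ hτ => ?_⟩
    have hr1 : r < 1 := hrε.trans_le (min_le_left _ _)
    have hr2 : r * G < R := by
      rw [← lt_div_iff₀ hG]; exact hrε.trans_le (min_le_right _ _)
    have hrs : r ^ s ≤ r := pow_le_of_le_one hr.le hr1.le hs.ne'
    have hya : ‖a + τ • g 0 - a‖ < R := by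
      rw [add_sub_cancel_left, norm_smul]
      calc ‖τ‖ * ‖g 0‖ ≤ r * G := by gcongr; linarith [norm_nonneg τ]
        _ < R := hr2
    have := (le_abs_self _).trans (H.abs_le _ (mem_ball_iff_norm.2 hya))
    rw [pow_zero, mul_one]
    exact this.trans (by gcongr)
  | succ j ih =>
    obtain ⟨C₁, hC₁, ε₁, hε₁, h₁⟩ := ih (by omega)
    obtain ⟨C₂, hC₂, ε₂, hε₂, h₂⟩ := H.exists_recursion hg
    refine ⟨C₂ * (1 + C₁ * 2 ^ j), by positivity, min (min 1 (ε₁ / 2)) ε₂, by positivity,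
      fun r hr hrε τ hτ => ?_⟩
    rcases eq_or_ne τ 0 with rfl | hτ0
    · rw [zero_smul, add_zero, H.apply_zero]; positivity
    -- The recursion needs `‖τ‖ = q ^ s / 2` exactly. The induction hypothesis is used at radius `2
    -- * q`, because `q ^ s ≤ (2 * q) ^ s / 2`.
    obtain ⟨q, hq, hqs⟩ := exists_pow_eq_of_pos (x := 2 * ‖τ‖) (by positivity) hs.ne'
    have hqr : q ≤ r := by
      refine le_of_pow_le_pow_left₀ hs.ne' hr.le ?_
      rw [hqs]; linarith
    have hq1 : q ≤ 1 := hqr.trans (hrε.le.trans ((min_le_left _ _).trans (min_le_left _ _)))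
    have hq2 : 2 * q < ε₁ := by
      have : r < ε₁ / 2 := hrε.trans_le ((min_le_left _ _).trans (min_le_right _ _))
      linarith
    have hrec := h₂ q hq (hqr.trans_lt (hrε.trans_le (min_le_right _ _))) τ (by rw [hqs]; ring)
      (C₁ * (2 * q) ^ j) (fun τ' hτ' => h₁ (2 * q) (by positivity) hq2 τ' (by
        refine hτ'.trans ?_
        rw [mul_pow]
        have : (2 : ℝ) ≤ 2 ^ s := le_self_pow₀ one_le_two hs.ne'
        have h3 : 0 < q ^ s := by positivity
        nlinarith))
    refine hrec.trans ?_
    have h3 : q ^ N ≤ q ^ (j + 1) := pow_le_pow_of_le_one hq.le hq1 hj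
    have h4 : q ^ s ≤ q := pow_le_of_le_one hq.le hq1 hs.ne'
    have h5 : q ^ (j + 1) ≤ r ^ (j + 1) := by gcongr
    calc C₂ * (q ^ N + q ^ s * (C₁ * (2 * q) ^ j))
        ≤ C₂ * (q ^ (j + 1) + q * (C₁ * (2 * q) ^ j)) := by gcongr
      _ = C₂ * (1 + C₁ * 2 ^ j) * q ^ (j + 1) := by rw [mul_pow, pow_succ]; ring
      _ ≤ C₂ * (1 + C₁ * 2 ^ j) * r ^ (j + 1) := by gcongr

/-- The line tangent to a curve has at least the normalised order of contact of the curve. -/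
theorem IsSupportSystem.isLittleO_tangent_line (H : IsSupportSystem ρ a ν ℓ R C)
    (hg : IsContactCurve ρ a g s N r₀ G K) {k : ℕ} (hk : k * s < N) (u : ℂ) :
    (fun t : ℝ => ρ (a + t • (u • g 0))) =o[𝓝[>] 0] fun t => t ^ k := by
  have hs := hg.s_pos
  obtain ⟨C', hC', ε, hε, h⟩ := H.exists_le_pow hg le_rfl
  have hdir := H.apply_direction_eq_zero hg
  rw [Asymptotics.isLittleO_iff]
  intro c hc
  set B : ℝ := C' ^ s * (2 * (‖u‖ + 1)) ^ N with hB
  have hB0 : 0 < B := by positivity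
  have ht1 : ∀ᶠ t : ℝ in 𝓝[>] 0, t < 1 ∧ 2 * (t * (‖u‖ + 1)) < ε ^ s ∧
      t * (‖u‖ * ‖g 0‖) < R ∧ B * t < c ^ s := by
    have hev : ∀ (m b : ℝ), 0 < b → ∀ᶠ t : ℝ in 𝓝[>] 0, t * m < b := by
      intro m b hb
      have : Tendsto (fun t : ℝ => t * m) (𝓝 0) (𝓝 (0 * m)) :=
        (continuous_id.mul continuous_const).tendsto 0
      rw [zero_mul] at this
      exact (this.mono_left nhdsWithin_le_nhds).eventually (gt_mem_nhds hb)
    filter_upwards [hev 1 1 one_pos, hev (2 * (‖u‖ + 1)) (ε ^ s) (by positivity),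
      hev (‖u‖ * ‖g 0‖) R H.R_pos, hev B (c ^ s) (by positivity)] with t h1 h2 h3 h4
    exact ⟨by simpa using h1, by linarith, h3, by linarith⟩
  filter_upwards [ht1, self_mem_nhdsWithin] with t ⟨hlt, h2, h3, h4⟩ htpos
  rw [mem_Ioi] at htpos
  have heq : a + t • (u • g 0) = a + ((t : ℂ) * u) • g 0 := by
    rw [← Complex.coe_smul, smul_smul]
  have hnτ : ‖(t : ℂ) * u‖ = t * ‖u‖ := by
    rw [norm_mul, Complex.norm_real, Real.norm_of_nonneg htpos.le]
  rw [heq]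
  set p : ℝ := ρ (a + ((t : ℂ) * u) • g 0) with hp
  have hp0 : 0 ≤ p := H.nonneg_of_apply_eq_zero hdir (by rw [norm_smul, hnτ]; linarith)
  obtain ⟨q, hq, hqs⟩ := exists_pow_eq_of_pos (x := 2 * (t * (‖u‖ + 1))) (by positivity) hs.ne'
  have hqε : q < ε := lt_of_pow_lt_pow_left₀ s hε.le (by rw [hqs]; exact h2)
  have hpq : p ≤ C' * q ^ N := h q hq hqε _ (by rw [hqs, hnτ]; linarith)
  rw [Real.norm_of_nonneg hp0, Real.norm_of_nonneg (by positivity)]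
  -- Comparing `s`-th powers avoids the exponent `N / s`; the spare factor `t` from `k * s + 1 ≤ N`
  -- gives the little-o.
  refine le_of_pow_le_pow_left₀ hs.ne' (by positivity) ?_
  calc p ^ s ≤ (C' * q ^ N) ^ s := by gcongr
    _ = C' ^ s * (q ^ s) ^ N := by rw [mul_pow, ← pow_mul, ← pow_mul, mul_comm N s]
    _ = B * t ^ N := by rw [hqs, hB, mul_assoc, ← mul_pow]; ring
    _ ≤ B * t ^ (k * s + 1) := by
      gcongr B * ?_
      exact pow_le_pow_of_le_one htpos.le hlt.le hk
    _ = (B * t) * t ^ (k * s) := by ring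
    _ ≤ c ^ s * t ^ (k * s) := by gcongr
    _ = (c * t ^ k) ^ s := by rw [mul_pow, pow_mul]

end

/-! ### Directions of high contact -/

/-- The unit vectors `X` such that the Taylor coefficients of `ρ` at `a` of order at most `k` vanish
on the complex line through `a` in the direction `X`. -/
def flatDirections {n : ℕ} (ρ : Cn n → ℝ) (a : Cn n) (k : ℕ) : Set (Cn n) :=
  {X | ‖X‖ = 1 ∧ ∀ u : ℂ, ∀ i ≤ k, iteratedFDeriv ℝ i ρ a (fun _ => u • X) = 0}

theorem isClosed_flatDirections {n : ℕ} (ρ : Cn n → ℝ) (a : Cn n) (k : ℕ) :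
    IsClosed (flatDirections ρ a k) := by
  have h : flatDirections ρ a k = {X | ‖X‖ = 1} ∩ ⋂ u : ℂ, ⋂ i : ℕ, ⋂ _ : i ≤ k,
      {X | iteratedFDeriv ℝ i ρ a (fun _ => u • X) = 0} := by
    ext X; simp [flatDirections]
  rw [h]
  refine (isClosed_eq continuous_norm continuous_const).inter
    (isClosed_iInter fun u => isClosed_iInter fun i => isClosed_iInter fun _ =>
      isClosed_eq ?_ continuous_const)
  exact (iteratedFDeriv ℝ i ρ a).cont.comp (by fun_prop)

theorem flatDirections_antitone {n : ℕ} (ρ : Cn n → ℝ) (a : Cn n) :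
    Antitone (flatDirections ρ a) :=
  fun _ _ hkl _ hX => ⟨hX.1, fun u i hi => hX.2 u i (hi.trans hkl)⟩

/-- If all the sets of flat directions are non-empty, then so is their intersection. -/
theorem exists_mem_all_flatDirections {n : ℕ} {ρ : Cn n → ℝ} {a : Cn n}
    (h : ∀ k, 1 ≤ k → (flatDirections ρ a k).Nonempty) : ∃ X, ∀ k, X ∈ flatDirections ρ a k := by
  have hne : ∀ k, (flatDirections ρ a k).Nonempty := fun k =>
    (h (k + 1) (by omega)).mono (flatDirections_antitone ρ a (Nat.le_succ k))
  have hc : IsCompact (flatDirections ρ a 0) :=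
    (isCompact_sphere (0 : Cn n) 1).of_isClosed_subset (isClosed_flatDirections ρ a 0)
      fun X hX => mem_sphere_zero_iff_norm.2 hX.1
  obtain ⟨X, hX⟩ := IsCompact.nonempty_iInter_of_sequence_nonempty_isCompact_isClosed
    (flatDirections ρ a) (fun k => flatDirections_antitone ρ a (Nat.le_succ k)) hne hc
    (isClosed_flatDirections ρ a)
  exact ⟨X, fun k => mem_iInter.1 hX k⟩

theorem mem_complexTangent_of_mem_flatDirections {n : ℕ} {ρ : Cn n → ℝ} {a X : Cn n} {k : ℕ}
    (hk : 1 ≤ k) (hX : X ∈ flatDirections ρ a k) : X ∈ complexTangent ρ a := by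
  have h1 := hX.2 1 1 hk
  have h2 := hX.2 Complex.I 1 hk
  rw [iteratedFDeriv_one_apply] at h1 h2
  rw [one_smul] at h1
  exact ⟨h1, h2⟩

theorem exists_le_of_mem_flatDirections {n : ℕ} {ρ : Cn n → ℝ} {a X : Cn n} {k : ℕ}
    (hρ : ContDiffAt ℝ ∞ ρ a) (hX : X ∈ flatDirections ρ a k) :
    ∃ C : ℝ, 0 < C ∧ ∃ ε : ℝ, 0 < ε ∧ ∀ ζ : ℂ, ‖ζ‖ < ε → ρ (a + ζ • X) ≤ C * ‖ζ‖ ^ (k + 1) := by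
  obtain ⟨C, hC, ε, hε, h⟩ := exists_norm_sub_taylor_le hρ (k + 1)
  refine ⟨C, hC, ε, hε, fun ζ hζ => ?_⟩
  have hn : ‖ζ • X‖ = ‖ζ‖ := by rw [norm_smul, hX.1, mul_one]
  have h1 := h (ζ • X) (by rwa [hn])
  rw [Finset.sum_eq_zero fun i hi => by
    rw [hX.2 ζ i (Nat.lt_succ_iff.1 (Finset.mem_range.1 hi)), mul_zero], sub_zero, hn] at h1
  exact (le_abs_self _).trans h1

/-! ### Consequences of smoothness and `ℂ`-convexity at the boundary point -/

section DefiningFunction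

variable {n : ℕ} {D : Set (Cn n)} {a : Cn n} {ρ : Cn n → ℝ}

theorem IsSmoothDefiningFunctionNear.contDiffAt (hρ : IsSmoothDefiningFunctionNear D a ρ) :
    ContDiffAt ℝ ∞ ρ a := by
  obtain ⟨U, hU, haU, hc, -⟩ := hρ
  exact hc.contDiffAt (hU.mem_nhds haU)

theorem IsSmoothDefiningFunctionNear.fderiv_ne_zero (hρ : IsSmoothDefiningFunctionNear D a ρ)
    (ha : a ∈ frontier D) : fderiv ℝ ρ a ≠ 0 := by
  obtain ⟨U, hU, haU, hc, -, h⟩ := hρ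
  exact h a ⟨ha, haU⟩

theorem IsSmoothDefiningFunctionNear.apply_eq_zero (hρ : IsSmoothDefiningFunctionNear D a ρ)
    (hD : IsOpen D) (ha : a ∈ frontier D) : ρ a = 0 := by
  have hcont := hρ.contDiffAt.continuousAt
  obtain ⟨U, hU, haU, hc, hDU, -⟩ := hρ
  have hmem : ∀ x ∈ U, x ∈ D ↔ ρ x < 0 := fun x hx =>
    ⟨fun h => ((Set.ext_iff.1 hDU x).1 ⟨h, hx⟩).2, fun h => ((Set.ext_iff.1 hDU x).2 ⟨hx, h⟩).1⟩
  have haD : a ∉ D := by rw [hD.frontier_eq] at ha; exact ha.2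
  refine le_antisymm ?_ (not_lt.1 fun h => haD ((hmem a haU).2 h))
  by_contra! hpos
  have h1 : ∀ᶠ x in 𝓝 a, 0 < ρ x ∧ x ∈ U := (hcont.eventually (lt_mem_nhds hpos)).and
    (hU.mem_nhds haU)
  obtain ⟨x, hxD, hx⟩ := ((mem_closure_iff_frequently.1 (frontier_subset_closure ha)).and_eventually
    h1).exists
  exact absurd ((hmem x hx.2).1 hxD) (not_lt.2 hx.1.le)

theorem IsSmoothDefiningFunctionNear.exists_isSupportSystem
    (hρ : IsSmoothDefiningFunctionNear D a ρ) (hD : IsOpen D) (ha : a ∈ frontier D)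
    (hconv : IsCConvexNear D a) : ∃ ν ℓ R C, IsSupportSystem ρ a ν ℓ R C := by
  have hd := hρ.fderiv_ne_zero ha
  have hsm := hρ.contDiffAt
  refine _root_.exists_isSupportSystem hsm (hρ.apply_eq_zero hD ha) hd ?_
  obtain ⟨U, hU, haU, hc, hDU, -⟩ := hρ
  obtain ⟨U', hU', haU', hconv⟩ := hconv
  have hle : ∀ m : ℕ, (m : WithTop ℕ∞) ≤ (∞ : WithTop ℕ∞) := fun m => by exact_mod_cast le_top
  have hfc : ContinuousAt (fderiv ℝ ρ) a :=
    ((hsm.of_le (hle 1)).fderiv_right (m := 0) (by norm_num)).continuousAt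
  obtain ⟨R, hR, hball⟩ := Metric.eventually_nhds_iff_ball.1
    (((hU.eventually_mem haU).and (hU'.eventually_mem haU')).and
      (hfc.eventually_ne hd))
  have hmem : ∀ x ∈ U, x ∈ D ↔ ρ x < 0 := fun x hx =>
    ⟨fun h => ((Set.ext_iff.1 hDU x).1 ⟨h, hx⟩).2, fun h => ((Set.ext_iff.1 hDU x).2 ⟨hx, h⟩).1⟩
  refine ⟨R, hR, fun x hx hx0 V hxV hV hIV => ?_⟩
  obtain ⟨⟨hxU, hxU'⟩, hxd⟩ := hball x hx
  obtain ⟨⟨hyU, hyU'⟩, -⟩ := hball _ hxV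
  have hxS : x ∉ D ∩ U' := fun h => absurd ((hmem x hxU).1 h.1) (by rw [hx0]; exact lt_irrefl 0)
  have hnot := hconv.add_notMem (hD.inter hU') hxS
    ((hc.contDiffAt (hU.mem_nhds hxU)).differentiableAt (by simp)) hx0
    (by
      filter_upwards [hU.mem_nhds hxU, hU'.mem_nhds hxU'] with y hyU hyU' hy
      exact ⟨(hmem y hyU).2 hy, hyU'⟩) hxd hV hIV
  exact not_lt.1 fun h => hnot ⟨(hmem _ hyU).2 h, hyU'⟩

end DefiningFunction

/-- A holomorphic germ with normalised order of contact greater than `k` can be parametrised as a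
curve `a + ζ ^ s • g ζ` with contact of order `N > k * s`. -/
theorem exists_isContactCurve {n : ℕ} {ρ : Cn n → ℝ} {a : Cn n} {k : ℕ} (hk : 1 ≤ k)
    (h : (k : ℝ≥0∞) < contactType ρ a) :
    ∃ g s N r₀ G K, IsContactCurve ρ a g s N r₀ G K ∧ k * s < N ∧ g 0 ≠ 0 := by
  obtain ⟨γ, h⟩ := lt_iSup_iff.1 h
  obtain ⟨⟨hγ, hγ0, hγne⟩, h⟩ := lt_iSup_iff.1 h
  have hγa : AnalyticAt ℂ (fun ζ => γ ζ - a) 0 := hγ.sub analyticAt_const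
  obtain ⟨s, g, hg, hg0, heq⟩ := hγa.exists_eventuallyEq_pow_smul_nonzero_iff.2 (by
    simpa [sub_eq_zero] using hγne)
  simp only [sub_zero] at heq
  have hs : s ≠ 0 := by
    rintro rfl
    have := heq.self_of_nhds
    rw [hγ0, sub_self, pow_zero, one_smul] at this
    exact hg0 this.symm
  have hgbd : ∀ᶠ ζ in 𝓝 (0 : ℂ), ‖g ζ‖ < ‖g 0‖ + 1 :=
    hg.continuousAt.norm.eventually (gt_mem_nhds (by linarith))
  have hOs : (fun ζ => γ ζ - a) =O[𝓝 0] fun ζ : ℂ => ‖ζ‖ ^ s := by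
    refine Asymptotics.IsBigO.of_bound (‖g 0‖ + 1) ?_
    filter_upwards [heq, hgbd] with ζ h1 h2
    rw [h1, norm_smul, norm_pow, norm_pow, norm_norm, mul_comm]
    gcongr
  -- This inequality suffices: replacing the denominator by `s` can only enlarge the quotient.
  have hV2 : (s : ℕ∞) ≤ vanishingOrder fun ζ => γ ζ - a :=
    le_iSup₂_of_le (f := fun (k : ℕ) (_ : (fun ζ => γ ζ - a) =O[𝓝 0] fun ζ : ℂ => ‖ζ‖ ^ k) =>
      (k : ℕ∞)) s hOs le_rfl
  have hV1 : ((k * s : ℕ) : ℕ∞) < vanishingOrder fun ζ => ρ (γ ζ) := by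
    have h1 : (k : ℝ≥0∞) < ((vanishingOrder fun ζ => ρ (γ ζ) : ℕ∞) : ℝ≥0∞) / (s : ℝ≥0∞) := by
      refine h.trans_le (ENNReal.div_le_div_left ?_ _)
      exact_mod_cast ENat.toENNReal_le.2 hV2
    have h2 := ENNReal.mul_lt_of_lt_div h1
    rw [← ENat.toENNReal_lt]
    exact_mod_cast h2
  obtain ⟨N, hN⟩ := lt_iSup_iff.1 hV1
  obtain ⟨hO, hN⟩ := lt_iSup_iff.1 hN
  have hN' : k * s < N := by exact_mod_cast hN
  obtain ⟨K, hK, hKb⟩ := hO.exists_pos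
  obtain ⟨r₀, hr₀, hball⟩ := Metric.eventually_nhds_iff_ball.1
    (((heq.and hgbd).and hKb.bound).and hg.eventually_analyticAt)
  refine ⟨g, s, N, r₀, ‖g 0‖ + 1, K, ⟨hr₀, Nat.pos_of_ne_zero hs, ?_, by positivity, hK,
    fun ζ hζ => (hball ζ hζ).2.differentiableAt.differentiableWithinAt,
    fun ζ hζ => (hball ζ hζ).1.1.2.le, fun ζ hζ => ?_⟩, hN', hg0⟩
  · exact (Nat.le_mul_of_pos_left s hk).trans_lt hN'
  · have h1 := (hball ζ hζ).1.2
    rw [← (hball ζ hζ).1.1.1, add_sub_cancel]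
    rw [norm_pow, norm_norm] at h1
    exact (le_abs_self _).trans h1

/-- If the type of a `ℂ`-convex boundary point is greater than `k`, then there is a complex line
whose order of contact is greater than `k`. -/
theorem flatDirections_nonempty {n : ℕ} {D : Set (Cn n)} {a : Cn n} {ρ : Cn n → ℝ}
    (hρ : IsSmoothDefiningFunctionNear D a ρ) (hD : IsOpen D) (ha : a ∈ frontier D)
    (hconv : IsCConvexNear D a) {k : ℕ} (hk : 1 ≤ k) (h : (k : ℝ≥0∞) < contactType ρ a) :
    (flatDirections ρ a k).Nonempty := by
  obtain ⟨ν, ℓ, R, C, H⟩ := hρ.exists_isSupportSystem hD ha hconv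
  obtain ⟨g, s, N, r₀, G, K, hg, hN, hg0⟩ := exists_isContactCurve hk h
  refine ⟨((‖g 0‖⁻¹ : ℝ) : ℂ) • g 0, ?_, fun u i hi => ?_⟩
  · rw [norm_smul, Complex.norm_real, norm_inv, norm_norm, inv_mul_cancel₀ (norm_ne_zero_iff.2 hg0)]
  · rw [smul_smul]
    exact iteratedFDeriv_eq_zero_of_isLittleO hρ.contDiffAt (H.isLittleO_tangent_line hg hN _) i hi

/-! ### Discs in the direction of high contact -/

theorem lempertStar_le_of_disc {n : ℕ} {D : Set (Cn n)} {z X : Cn n} {r : ℝ} (hr : 0 < r)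
    (hdisc : ∀ μ : ℂ, ‖μ‖ < r → z + μ • X ∈ D) {t : ℂ} (ht : ‖t‖ < r) :
    lempertStar D z (z + t • X) ≤ ENNReal.ofReal (‖t‖ / r) := by
  have hrC : (r : ℂ) ≠ 0 := by exact_mod_cast hr.ne'
  have hn : ‖t / r‖ = ‖t‖ / r := by rw [norm_div, Complex.norm_real, Real.norm_of_nonneg hr.le]
  refine (iInf₂_le_of_le 0 (t / r) (iInf_le_of_le ⟨by simp, ?_, fun ξ => z + (r * ξ) • X, ?_,
    fun ξ hξ => hdisc _ ?_, by simp, ?_⟩ le_rfl)).trans ?_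
  · simp [abs_of_pos hr]
  · rw [mem_ball_zero_iff, hn, div_lt_one hr]; exact ht
  · exact Differentiable.differentiableOn (by fun_prop)
  · rw [norm_mul, Complex.norm_real, Real.norm_of_nonneg hr.le]
    exact mul_lt_of_lt_one_right hr (mem_ball_zero_iff.1 hξ)
  · simp only [mul_div_cancel₀ t hrC]

/-- The estimate of the Lempert function along the inner normal in a direction of contact of
order `2 * m`, on a piece of the normal independent of the direction and of `m`. -/
theorem exists_lempertStar_le {n : ℕ} {D : Set (Cn n)} {a : Cn n} {ρ : Cn n → ℝ}
    (hρ : IsSmoothDefiningFunctionNear D a ρ) (hD : IsOpen D) (ha : a ∈ frontier D) :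
    ∃ ε : ℝ, 0 < ε ∧ ∀ (X : Cn n) (m : ℕ), ‖X‖ = 1 → 1 ≤ m →
      (∃ C₀ : ℝ, 0 < C₀ ∧ ∃ ε₀ : ℝ, 0 < ε₀ ∧
        ∀ ζ : ℂ, ‖ζ‖ < ε₀ → ρ (a + ζ • X) ≤ C₀ * ‖ζ‖ ^ (2 * m)) →
      ∃ C : ℝ, 0 < C ∧ ∀ z ∈ innerNormal ρ a, ‖z - a‖ < ε → ∀ t : ℂ,
        C * ‖t‖ / bdryDist D z ^ (1 / (2 * (m : ℝ))) < 1 →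
          z + t • X ∈ D ∧ lempertStar D z (z + t • X) ≤
            ENNReal.ofReal (C * ‖t‖ / bdryDist D z ^ (1 / (2 * (m : ℝ)))) := by
  have hd := hρ.fderiv_ne_zero ha
  have h0 := hρ.apply_eq_zero hD ha
  have hsm := hρ.contDiffAt
  obtain ⟨U, hU, haU, hc, hDU, -⟩ := hρ
  have haD : a ∉ D := by rw [hD.frontier_eq] at ha; exact ha.2
  have hle : ∀ m : ℕ, (m : WithTop ℕ∞) ≤ (∞ : WithTop ℕ∞) := fun m => by exact_mod_cast le_top
  have hfc : ContinuousAt (fderiv ℝ ρ) a :=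
    ((hsm.of_le (hle 1)).fderiv_right (m := 0) (by norm_num)).continuousAt
  set L := fderiv ℝ ρ a with hL
  have hLpos : 0 < ‖L‖ := norm_pos_iff.2 hd
  obtain ⟨R₁, hR₁, hball⟩ := Metric.eventually_nhds_iff_ball.1
    ((hU.eventually_mem haU).and
      (hfc.eventually (Metric.ball_mem_nhds _ (by positivity : 0 < ‖L‖ / 4))))
  set R : ℝ := min R₁ 1 with hRdef
  have hR : 0 < R := by positivity
  have hRsub : Metric.ball a R ⊆ Metric.ball a R₁ := Metric.ball_subset_ball (min_le_left _ _)
  have hmv : ∀ y ∈ Metric.ball a R, ∀ w, y + w ∈ Metric.ball a R →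
      ρ (y + w) ≤ ρ y + L w + ‖L‖ / 4 * ‖w‖ := by
    intro y hy w hyw
    have := Convex.norm_image_sub_le_of_norm_fderiv_le' (𝕜 := ℝ) (f := ρ) (φ := L)
      (s := Metric.ball a R) (C := ‖L‖ / 4) (fun x hx =>
        (hc.contDiffAt (hU.mem_nhds (hball x (hRsub hx)).1)).differentiableAt (by simp))
      (fun x hx => (mem_ball_iff_norm.1 (hball x (hRsub hx)).2).le) (convex_ball a R) hy hyw
    rw [add_sub_cancel_left, Real.norm_eq_abs] at this
    linarith [(abs_le.1 this).2]
  refine ⟨R / 2, by positivity, fun X m hX hm ⟨C₀, hC₀, ε₀, hε₀, hflat⟩ => ?_⟩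
  -- The summands give `C ≤ C ^ (2 * m)`, beat the contact bound by `‖L‖ * ‖w‖`, and confine `μ` to
  -- `ε₀` and to `R / 2`. Since `ε₀` enters only here, the length of the normal piece is independent
  -- of `X` and `m`.
  set C : ℝ := 1 + 2 * C₀ / ‖L‖ + 1 / ε₀ + 2 / R with hCdef
  have hC : 0 < C := by positivity
  have hC1 : 1 ≤ C := by
    rw [hCdef]
    have : 0 ≤ 2 * C₀ / ‖L‖ + 1 / ε₀ + 2 / R := by positivity
    linarith
  have hCL : 2 * C₀ ≤ C * ‖L‖ := by
    rw [← div_le_iff₀ hLpos, hCdef]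
    have : 0 ≤ 1 / ε₀ + 2 / R := by positivity
    linarith
  have hCε : 1 ≤ C * ε₀ := by
    rw [← div_le_iff₀ hε₀, hCdef]
    have : 0 ≤ 2 * C₀ / ‖L‖ + 2 / R := by positivity
    linarith
  have hCR : 2 ≤ C * R := by
    rw [← div_le_iff₀ hR, hCdef]
    have : 0 ≤ 2 * C₀ / ‖L‖ + 1 / ε₀ := by positivity
    linarith
  refine ⟨C, hC, fun z hz hza => ?_⟩
  obtain ⟨t₀, ht₀, hgrad⟩ := hz
  set w : Cn n := z - a with hw
  have hwR : ‖w‖ < R / 2 := hza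
  -- As `w = -t₀ ∇ρ(a)`, the form `L` attains its norm on `w`, with negative sign.
  have hLw : L w ≤ -(‖L‖ * ‖w‖) := by
    have h1 : ‖L‖ ≤ ‖w‖ / t₀ := by
      refine L.opNorm_le_bound (by positivity) fun Y => ?_
      have h2 : |t₀ * L Y| ≤ ‖w‖ * ‖Y‖ := by
        have h3 := (Complex.abs_re_le_norm _).trans (norm_inner_le_norm (𝕜 := ℂ) w Y)
        rw [hgrad Y, neg_mul, abs_neg] at h3
        exact h3
      rw [abs_mul, abs_of_pos ht₀] at h2
      rw [Real.norm_eq_abs, div_mul_eq_mul_div, le_div_iff₀ ht₀]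
      linarith
    have h2 := hgrad w
    have h3 : (inner ℂ w w).re = ‖w‖ ^ 2 := (norm_sq_eq_re_inner (𝕜 := ℂ) w).symm
    rw [h3] at h2
    rw [le_div_iff₀ ht₀] at h1
    have h4 : t₀ * (‖L‖ * ‖w‖ + L w) ≤ 0 := by
      nlinarith [norm_nonneg w]
    have h5 : ‖L‖ * ‖w‖ + L w ≤ 0 := by
      by_contra! hcon
      exact absurd h4 (not_le.2 (mul_pos ht₀ hcon))
    linarith
  have hw0 : 0 < ‖w‖ := by
    refine norm_pos_iff.2 fun hw0 => hd (ContinuousLinearMap.ext fun Y => ?_)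
    have := hgrad Y
    rw [hw0, inner_zero_left, Complex.zero_re] at this
    simpa [ht₀.ne'] using this
  -- Moving by `w` lowers `ρ` by at least `3/4 * ‖L‖ * ‖w‖`, and the contact bound uses up at most
  -- half of `‖L‖ * ‖w‖`.
  have hin : ∀ μ : ℂ, ‖μ‖ < ε₀ → ‖μ‖ < R / 2 → 2 * (C₀ * ‖μ‖ ^ (2 * m)) ≤ ‖L‖ * ‖w‖ →
      z + μ • X ∈ D := by
    intro μ h1 h2 h3
    have hμX : ‖μ • X‖ = ‖μ‖ := by rw [norm_smul, hX, mul_one]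
    have hy : a + μ • X ∈ Metric.ball a R :=
      mem_ball_iff_norm.2 (by rw [add_sub_cancel_left, hμX]; linarith)
    have hzy : z + μ • X = a + μ • X + w := by rw [hw]; abel
    have hyw : a + μ • X + w ∈ Metric.ball a R := mem_ball_iff_norm.2 (by
      rw [show a + μ • X + w - a = μ • X + w by abel]
      refine (norm_add_le _ _).trans_lt ?_
      rw [hμX]; linarith)
    rw [hzy]
    refine ((Set.ext_iff.1 hDU _).2 ⟨(hball _ (hRsub hyw)).1, ?_⟩).1
    have h4 := hmv _ hy w hyw
    have h5 := hflat μ h1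
    have h6 : 0 < ‖L‖ * ‖w‖ := by positivity
    linarith
  have hzD : z ∈ D := by
    have := hin 0 (by simpa using hε₀) (by simp; positivity) (by
      rw [norm_zero, zero_pow (by omega), mul_zero, mul_zero]; positivity)
    simpa using this
  set δ : ℝ := bdryDist D z with hδ
  have hδ0 : 0 < δ :=
    (hD.isClosed_compl.notMem_iff_infDist_pos ⟨a, haD⟩).1 (fun h => h hzD)
  have hδw : δ ≤ ‖w‖ := by
    rw [hw, ← dist_eq_norm]; exact Metric.infDist_le_dist_of_mem haD
  have hδ1 : δ ≤ 1 := by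
    have : R ≤ 1 := min_le_right _ _
    linarith
  set q : ℝ := δ ^ (1 / (2 * (m : ℝ))) with hq
  have hq0 : 0 < q := Real.rpow_pos_of_pos hδ0 _
  have hq1 : q ≤ 1 := Real.rpow_le_one hδ0.le hδ1 (by positivity)
  have hqδ : q ^ (2 * m) = δ := by
    have := Real.rpow_inv_natCast_pow hδ0.le (n := 2 * m) (by omega)
    rw [hq, one_div]
    push_cast at this
    exact this
  have hdisc : ∀ μ : ℂ, ‖μ‖ < q / C → z + μ • X ∈ D := by
    intro μ hμ
    rw [lt_div_iff₀ hC] at hμ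
    have hμC : C * ‖μ‖ < 1 := by linarith
    refine hin μ ?_ ?_ ?_
    · by_contra! hcon
      nlinarith
    · by_contra! hcon
      nlinarith
    · have h1 : (‖μ‖ * C) ^ (2 * m) ≤ ‖w‖ := by
        calc (‖μ‖ * C) ^ (2 * m) ≤ q ^ (2 * m) := by gcongr
          _ = δ := hqδ
          _ ≤ ‖w‖ := hδw
      have h2 : C ≤ C ^ (2 * m) := le_self_pow₀ hC1 (by omega)
      rw [mul_pow] at h1
      have h3 : 0 ≤ ‖μ‖ ^ (2 * m) := by positivity
      calc 2 * (C₀ * ‖μ‖ ^ (2 * m)) = 2 * C₀ * ‖μ‖ ^ (2 * m) := by ring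
        _ ≤ C * ‖L‖ * ‖μ‖ ^ (2 * m) := by gcongr
        _ ≤ C ^ (2 * m) * ‖L‖ * ‖μ‖ ^ (2 * m) := by gcongr
        _ = ‖L‖ * (‖μ‖ ^ (2 * m) * C ^ (2 * m)) := by ring
        _ ≤ ‖L‖ * ‖w‖ := by gcongr
  intro t ht
  have htq : ‖t‖ < q / C := by
    rw [div_lt_one hq0] at ht
    rw [lt_div_iff₀ hC]; linarith
  have he : ‖t‖ / (q / C) = C * ‖t‖ / q := by field_simp
  exact ⟨hdisc t htq, he ▸ lempertStar_le_of_disc (by positivity) hdisc htq⟩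
theorem mainTheorem11 (n : ℕ) (hn : 2 ≤ n) (D : Set (Cn n)) (hDopen : IsOpen D)
    (hDconn : IsConnected D) (a : Cn n) (ha : a ∈ frontier D) (hconv : IsCConvexNear D a)
    (ρ : Cn n → ℝ) (hρ : IsSmoothDefiningFunctionNear D a ρ) :
    (∀ m : ℕ, 1 ≤ m → contactType ρ a = ((2 * m : ℕ) : ℝ≥0∞) →
      ∃ X : Cn n, X ∈ complexTangent ρ a ∧ ‖X‖ = 1 ∧
        ∃ ε : ℝ, 0 < ε ∧ ∃ C : ℝ, 0 < C ∧
          ∀ z ∈ innerNormal ρ a, ‖z - a‖ < ε → ∀ t : ℂ,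
            C * ‖t‖ / bdryDist D z ^ (1 / (2 * (m : ℝ))) < 1 →
              z + t • X ∈ D ∧
              lempertStar D z (z + t • X) ≤
                ENNReal.ofReal (C * ‖t‖ / bdryDist D z ^ (1 / (2 * (m : ℝ))))) ∧
    (contactType ρ a = ⊤ →
      ∃ X : Cn n, X ∈ complexTangent ρ a ∧ ‖X‖ = 1 ∧
        ∃ ε : ℝ, 0 < ε ∧ ∀ m : ℕ, 1 ≤ m → ∃ C : ℝ, 0 < C ∧
          ∀ z ∈ innerNormal ρ a, ‖z - a‖ < ε → ∀ t : ℂ,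
            C * ‖t‖ / bdryDist D z ^ (1 / (2 * (m : ℝ))) < 1 →
              z + t • X ∈ D ∧
              lempertStar D z (z + t • X) ≤
                ENNReal.ofReal (C * ‖t‖ / bdryDist D z ^ (1 / (2 * (m : ℝ))))) := by

  obtain ⟨ε, hε, hdisc⟩ := exists_lempertStar_le hρ hDopen ha
  have key : ∀ m : ℕ, 1 ≤ m → ∀ X ∈ flatDirections ρ a (2 * m - 1),
      ∃ C₀ : ℝ, 0 < C₀ ∧ ∃ ε₀ : ℝ, 0 < ε₀ ∧
        ∀ ζ : ℂ, ‖ζ‖ < ε₀ → ρ (a + ζ • X) ≤ C₀ * ‖ζ‖ ^ (2 * m) := by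
    intro m hm X hX
    have := exists_le_of_mem_flatDirections hρ.contDiffAt hX
    rwa [Nat.sub_add_cancel (by omega)] at this
  constructor
  · intro m hm htype
    -- Since `2 * m - 1` is strictly below the type, the supremum need not be attained; flatness to
    -- this order already gives the bound by `|ζ| ^ (2 * m)`.
    obtain ⟨X, hX⟩ := flatDirections_nonempty hρ hDopen ha hconv (k := 2 * m - 1) (by omega)
      (by rw [htype]; exact_mod_cast (by omega : 2 * m - 1 < 2 * m))
    exact ⟨X, mem_complexTangent_of_mem_flatDirections (by omega) hX, hX.1, ε, hε,
      hdisc X m hX.1 hm (key m hm X hX)⟩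
  · intro htype
    obtain ⟨X, hX⟩ := exists_mem_all_flatDirections fun k hk =>
      flatDirections_nonempty hρ hDopen ha hconv hk (by rw [htype]; exact ENNReal.natCast_lt_top k)
    exact ⟨X, mem_complexTangent_of_mem_flatDirections le_rfl (hX 1), (hX 1).1, ε, hε,
      fun m hm => hdisc X m (hX 1).1 hm (key m hm X (hX _))⟩
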